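/- **Theorem (complexity of the Newton-CG method with known Hölder parameters, for an $\epsilon_g$-first-order stationary point).** *Problem.* Let $n\ge 1$, $f:\mathbb R^n\to\mathbb R$ twice continuously differentiable, $x^0\in\mathbb R^n$, and suppose that $L=\{x: f(x)\le f(x^0)\}$ is compact and that, on some bounded convex open set $\Omega\supseteq L$, $\|\nabla^2 f(x)-\nabla^2 f(y)\|\le H_\nu\|x-y\|^\nu$ for all $x,y\in\Omega$, with $\nu\in[0,1]$ and $H_\nu>0$. Let $f_{\rm low}\in\mathbb R$ and $U_H>0$ satisfy $f\ge f_{\rm low}$ and $\|\nabla^2 f\|\le U_H$ on $L$. Let $\epsilon_g,\zeta,\theta,\eta\in(0,1)$ and write $\gamma=\gamma_\nu(\epsilon_g)=4H_\nu^{2/(1+\nu)}\epsilon_g^{-(1-\nu)/(1+\nu)}$, $\varepsilon=(\gamma\epsilon_g)^{1/2}$. *Newton-CG method.* For $k=0,1,2,\dots$: if $\|\nabla f(x^k)\|\le\epsilon_g$, output $x^k$ and stop. Otherwise call the capped CG method below with $H=\nabla^2 f(x^k)$, $g=\nabla f(x^k)$, damping $\varepsilon$, accuracy $\zeta$, $U=0$,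 obtaining $d$ and its type, SOL or NC. If the type is SOL, set $d^k=d$; if $f(x^k+d^k)\le f(x^k)$ and $\|\nabla f(x^k+d^k)\|\le\epsilon_g$, set $\alpha_k=1$; otherwise $\alpha_k=\theta^{j}$ with the smallest integer $j\ge0$ such that $f(x^k+\theta^jd^k)\le f(x^k)-\eta(\gamma\epsilon_g)^{1/2}\theta^{2j}\|d^k\|^2$. If the type is NC, set $d^k=-\mathrm{sgn}(d^T\nabla f(x^k))\max\{1,1/\gamma\}\frac{|d^T\nabla^2f(x^k)d|}{\|d\|^3}d$ (with $\mathrm{sgn}(0)=1$) and $\alpha_k=\theta^j$ with the smallest integer $j\ge0$ such that $f(x^k+\theta^jd^k)\le f(x^k)-\eta\min\{1,\gamma\}\theta^{2j}\|d^k\|^3/4$. Set $x^{k+1}=x^k+\alpha_kd^k$. *Capped CG method* for $(H+2\varepsilon I)d=-g$. Put $\bar H=H+2\varepsilon I$ and, for the current value of $U$, $\kappa=(U+2\varepsilon)/\varepsilon$, $\hat\zeta=\zeta/(3\kappa)$, $\tau=\sqrt\kappa/(\sqrt\kappa+1)$, $T=4\kappa^4/(1-\sqrt\tau)^2$. Start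 with $y^0=0$, $r^0=g$, $p^0=-g$. If $(p^0)^T\bar Hp^0<\varepsilon\|p^0\|^2$, return $p^0$ (NC); else raise $U$ to $\|Hp^0\|/\|p^0\|$ if $\|Hp^0\|>U\|p^0\|$. Then repeat for $j=1,2,\dots$: do the standard CG step $\alpha_{j-1}=\|r^{j-1}\|^2/(p^{j-1})^T\bar Hp^{j-1}$, $y^{j}=y^{j-1}+\alpha_{j-1}p^{j-1}$, $r^{j}=r^{j-1}+\alpha_{j-1}\bar Hp^{j-1}$, $p^{j}=-r^{j}+(\|r^{j}\|^2/\|r^{j-1}\|^2)p^{j-1}$; for $v=p^j,y^j,r^j$ in turn, raise $U$ to $\|Hv\|/\|v\|$ if $\|Hv\|>U\|v\|$; then (1) if $(y^j)^T\bar Hy^j<\varepsilon\|y^j\|^2$, return $y^j$ (NC); (2) else if $\|r^j\|\le\hat\zeta\|r^0\|$, return $y^j$ (SOL); (3) else if $(p^j)^T\bar Hp^j<\varepsilon\|p^j\|^2$, return $p^j$ (NC); (4) else if $\|r^j\|>\sqrt T\tau^{j/2}\|r^0\|$, compute $y^{j+1}$ by a further CG step, find $i\in\{0,\dots,j-1\}$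 with $(y^{j+1}-y^i)^T\bar H(y^{j+1}-y^i)<\varepsilon\|y^{j+1}-y^i\|^2$, and return $y^{j+1}-y^i$ (NC). *Claim.* Let $c_{\rm sol}=\eta\min\Big\{\Big(\frac{2}{4+\zeta+\sqrt{(4+\zeta)^2+1}}\Big)^2,\frac16\Big(\frac{2(1-\eta)\theta}{3}\Big)^2\Big\}$, $c_{\rm nc}=\eta\theta^2/4$, $$K_1=\Big\lceil\frac{f(x^0)-f_{\rm low}}{\min\{c_{\rm sol},c_{\rm nc}\}}\gamma_\nu(\epsilon_g)^{1/2}\epsilon_g^{-3/2}\Big\rceil+1,\qquad X=H_\nu^{\frac1{1+\nu}}\epsilon_g^{-\frac{2+\nu}{1+\nu}},\qquad Y=\frac{U_H^{1/2}}{(H_\nu\epsilon_g^\nu)^{1/(2+2\nu)}} .$$ There is a constant $C>0$ depending only on $\zeta,\theta,\eta$ and an upper bound on $f(x^0)-f_{\rm low}$ such that the following holds. (i) Every execution of the method (whatever indices $i$ are found in (4)) is well defined (capped CG returns a direction and each line search succeeds) and terminates in at most $K_1$ iterations (even if the iteration in which the method stops is counted), and $K_1\le C\max\{1,X\}$, i.e.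 $K_1=O\big(H_\nu^{1/(1+\nu)}\epsilon_g^{-(2+\nu)/(1+\nu)}\big)$. Its output $x^k$, for some $0\le k\le K_1$, satisfies $\|\nabla f(x^k)\|\le\epsilon_g$. (ii) The total number of gradient evaluations and Hessian-vector products of $f$ used in any execution is at most $$C\max\{1,X\}\,\min\big\{n,\ \max\{1,Y\}\ln(2+Y)\big\},$$ i.e. $\widetilde O\big(H_\nu^{1/(1+\nu)}\epsilon_g^{-(2+\nu)/(1+\nu)}\min\{n,U_H^{1/2}/(H_\nu\epsilon_g^\nu)^{1/(2+2\nu)}\}\big)$. -/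

import Mathlib

open scoped Gradient InnerProductSpace

noncomputable section

namespace NewtonCG

/-- Euclidean space `ℝⁿ`, with the Euclidean norm. -/
abbrev E (n : ℕ) : Type := EuclideanSpace ℝ (Fin n)

/-- The Hessian `∇²f(x)`, as a linear operator: the derivative of the gradient map. Its operator
norm is the spectral norm. -/
def hessian {n : ℕ} (f : E n → ℝ) (x : E n) : E n →L[ℝ] E n :=
  fderiv ℝ (fun y => ∇ f y) x

/-- The level set `{x : f x ≤ f x₀}`. -/
def levelSet {n : ℕ} (f : E n → ℝ) (x₀ : E n) : Set (E n) := {x | f x ≤ f x₀}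

/-- The standing assumption: the level set of `x₀` is compact, `f` is twice continuously
differentiable on `ℝⁿ`, and `∇²f` is Hölder continuous with exponent `ν ∈ [0,1]` and modulus
`Hν > 0` on a bounded convex open neighbourhood `Ω` of the level set. -/
structure HolderHessian {n : ℕ} (f : E n → ℝ) (x₀ : E n) (ν Hν : ℝ) (Ω : Set (E n)) : Prop where
  compact_levelSet : IsCompact (levelSet f x₀)
  contDiff : ContDiff ℝ 2 f
  isOpen : IsOpen Ω
  convex : Convex ℝ Ω
  bounded : Bornology.IsBounded Ω
  subset : levelSet f x₀ ⊆ Ω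
  exponent_mem : ν ∈ Set.Icc (0 : ℝ) 1
  modulus_pos : 0 < Hν
  holder : ∀ x ∈ Ω, ∀ y ∈ Ω, ‖hessian f x - hessian f y‖ ≤ Hν * ‖x - y‖ ^ ν

/-! ### The capped conjugate gradient method for `(H + 2 ε I) d = -g` -/

/-- The type `d_type` of a returned direction. -/
inductive DType
  | SOL
  | NC

/-- The damped operator `H̄ = H + 2 ε I`. -/
def damped {n : ℕ} (H : E n →L[ℝ] E n) (ε : ℝ) : E n →L[ℝ] E n :=
  H + (2 * ε) • ContinuousLinearMap.id ℝ (E n)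

def kappa (ε U : ℝ) : ℝ := (U + 2 * ε) / ε

def zetaHat (ε ζ U : ℝ) : ℝ := ζ / (3 * kappa ε U)

def tau (ε U : ℝ) : ℝ := √(kappa ε U) / (√(kappa ε U) + 1)

def bigT (ε U : ℝ) : ℝ := 4 * kappa ε U ^ 4 / (1 - √(tau ε U)) ^ 2

/-- `vᵀ H̄ v < ε ‖v‖²`. -/
def NegCurv {n : ℕ} (H : E n →L[ℝ] E n) (ε : ℝ) (v : E n) : Prop :=
  ⟪v, damped H ε v⟫_ℝ < ε * ‖v‖ ^ 2

/-- The update "if `‖H v‖ > U ‖v‖` then `U ← ‖H v‖ / ‖v‖`". -/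
def raiseU {n : ℕ} (H : E n →L[ℝ] E n) (U : ℝ) (v : E n) : ℝ :=
  if ‖H v‖ > U * ‖v‖ then ‖H v‖ / ‖v‖ else U

/-- The variables of the method: the iterates `y^j`, `r^j`, `p^j`, the current value of `U`
(the quantities `κ, ζ̂, τ, T` are functions of it), and the number `hv` of products of `H` with
a vector formed so far. -/
structure CGState (n : ℕ) where
  y : E n
  r : E n
  p : E n
  U : ℝ
  hv : ℕ

/-- The state on entering the loop; the product `H p⁰` has been formed. -/
def cgInit {n : ℕ} (H : E n →L[ℝ] E n) (g : E n) (U₀ : ℝ) : CGState n where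
  y := 0
  r := g
  p := -g
  U := raiseU H U₀ (-g)
  hv := 1

/-- The step length `α_j`. -/
def cgAlpha {n : ℕ} (H : E n →L[ℝ] E n) (ε : ℝ) (s : CGState n) : ℝ :=
  ⟪s.r, s.r⟫_ℝ / ⟪s.p, damped H ε s.p⟫_ℝ

/-- The point `y^{j+1} = y^j + α_j p^j`. -/
def cgNextY {n : ℕ} (H : E n →L[ℝ] E n) (ε : ℝ) (s : CGState n) : E n :=
  s.y + cgAlpha H ε s • s.p

/-- The residual `r^{j+1} = r^j + α_j H̄ p^j`. -/
def cgNextR {n : ℕ} (H : E n →L[ℝ] E n) (ε : ℝ) (s : CGState n) : E n :=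
  s.r + cgAlpha H ε s • damped H ε s.p

/-- The direction `p^{j+1} = -r^{j+1} + β_{j+1} p^j`, with `β_{j+1} = ‖r^{j+1}‖² / ‖r^j‖²`. -/
def cgNextP {n : ℕ} (H : E n →L[ℝ] E n) (ε : ℝ) (s : CGState n) : E n :=
  -cgNextR H ε s + (‖cgNextR H ε s‖ ^ 2 / ‖s.r‖ ^ 2) • s.p

/-- One pass of the loop up to the termination tests: the standard CG operations, then the
updates of `U` at the new `p`, `y`, `r`. The product `H p^j` is already available; the three
products of `H` with the new `p`, `y`, `r` are counted (none is saved through recurrences). -/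
def cgNext {n : ℕ} (H : E n →L[ℝ] E n) (ε : ℝ) (s : CGState n) : CGState n where
  y := cgNextY H ε s
  r := cgNextR H ε s
  p := cgNextP H ε s
  U := raiseU H (raiseU H (raiseU H s.U (cgNextP H ε s)) (cgNextY H ε s)) (cgNextR H ε s)
  hv := s.hv + 3

/-- The state with loop index `j`, if no termination occurs before. Up to termination no divisor
in it vanishes, by the tests that have been passed. -/
def cgState {n : ℕ} (H : E n →L[ℝ] E n) (g : E n) (ε U₀ : ℝ) : ℕ → CGState n
  | 0 => cgInit H g U₀
  | j + 1 => cgNext H ε (cgState H g ε U₀ j)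

/-- `‖r^j‖ ≤ ζ̂ ‖r⁰‖`. -/
def Accurate {n : ℕ} (g : E n) (ε ζ : ℝ) (s : CGState n) : Prop :=
  ‖s.r‖ ≤ zetaHat ε ζ s.U * ‖g‖

/-- `‖r^j‖ > √T τ^{j/2} ‖r⁰‖`. -/
def SlowDecay {n : ℕ} (g : E n) (ε : ℝ) (j : ℕ) (s : CGState n) : Prop :=
  ‖s.r‖ > √(bigT ε s.U) * tau ε s.U ^ ((j : ℝ) / 2) * ‖g‖

/-- The method arrives at the termination tests with loop index `j ≥ 1`: the initial test and all
tests with a smaller index have failed. -/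
def CGReaches {n : ℕ} (H : E n →L[ℝ] E n) (g : E n) (ε ζ U₀ : ℝ) (j : ℕ) : Prop :=
  1 ≤ j ∧ ¬ NegCurv H ε (-g) ∧
    ∀ i : ℕ, 1 ≤ i → i < j →
      ¬ NegCurv H ε (cgState H g ε U₀ i).y ∧
      ¬ Accurate g ε ζ (cgState H g ε U₀ i) ∧
      ¬ NegCurv H ε (cgState H g ε U₀ i).p ∧
      ¬ SlowDecay g ε i (cgState H g ε U₀ i)

/-- `CappedCG H g ε ζ U₀ t d N`: the capped conjugate gradient method with these inputs can
terminate with `d_type = t` and output `d`, after forming `N` products of `H` with a vector. The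
only freedom is the choice of the index `i` in the last case; the search for `i` is charged with
one product for each of the `j` candidates. -/
inductive CappedCG {n : ℕ} (H : E n →L[ℝ] E n) (g : E n) (ε ζ U₀ : ℝ) :
    DType → E n → ℕ → Prop
  | initial (h : NegCurv H ε (-g)) : CappedCG H g ε ζ U₀ DType.NC (-g) 1
  | curvY (j : ℕ) (hj : CGReaches H g ε ζ U₀ j)
      (h₁ : NegCurv H ε (cgState H g ε U₀ j).y) :
      CappedCG H g ε ζ U₀ DType.NC (cgState H g ε U₀ j).y (cgState H g ε U₀ j).hv
  | solution (j : ℕ) (hj : CGReaches H g ε ζ U₀ j)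
      (h₁ : ¬ NegCurv H ε (cgState H g ε U₀ j).y)
      (h₂ : Accurate g ε ζ (cgState H g ε U₀ j)) :
      CappedCG H g ε ζ U₀ DType.SOL (cgState H g ε U₀ j).y (cgState H g ε U₀ j).hv
  | curvP (j : ℕ) (hj : CGReaches H g ε ζ U₀ j)
      (h₁ : ¬ NegCurv H ε (cgState H g ε U₀ j).y)
      (h₂ : ¬ Accurate g ε ζ (cgState H g ε U₀ j))
      (h₃ : NegCurv H ε (cgState H g ε U₀ j).p) :
      CappedCG H g ε ζ U₀ DType.NC (cgState H g ε U₀ j).p (cgState H g ε U₀ j).hv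
  | slow (j : ℕ) (hj : CGReaches H g ε ζ U₀ j)
      (h₁ : ¬ NegCurv H ε (cgState H g ε U₀ j).y)
      (h₂ : ¬ Accurate g ε ζ (cgState H g ε U₀ j))
      (h₃ : ¬ NegCurv H ε (cgState H g ε U₀ j).p)
      (h₄ : SlowDecay g ε j (cgState H g ε U₀ j))
      (i : ℕ) (hi : i < j)
      (h₅ : NegCurv H ε (cgNextY H ε (cgState H g ε U₀ j) - (cgState H g ε U₀ i).y)) :
      CappedCG H g ε ζ U₀ DType.NC
        (cgNextY H ε (cgState H g ε U₀ j) - (cgState H g ε U₀ i).y)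
        ((cgState H g ε U₀ j).hv + j)

/-! ### The Newton-CG method (no tolerance for second-order stationarity provided) -/

/-- The inputs: tolerance `εg`, CG accuracy `ζ`, backtracking ratio `θ`, line-search parameter
`η`, and the number `γ`. -/
structure NCGInput where
  εg : ℝ
  ζ : ℝ
  θ : ℝ
  η : ℝ
  γ : ℝ

/-- The inexact Lipschitz constant `γ_ν(ε) = 4 H_ν^{2/(1+ν)} ε^{-(1-ν)/(1+ν)}`. -/
def gammaNu (ν Hν ε : ℝ) : ℝ :=
  4 * Hν ^ (2 / (1 + ν)) * ε ^ (-((1 - ν) / (1 + ν)))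

/-- The sign, with `sgn 0 = 1`. -/
def sgn (s : ℝ) : ℝ := if 0 ≤ s then 1 else -1

/-- The direction `-sgn(dᵀ∇f(x)) max{1, 1/γ} (|dᵀ∇²f(x)d| / ‖d‖³) d`. -/
def ncDirection {n : ℕ} (f : E n → ℝ) (γ : ℝ) (x d : E n) : E n :=
  (-(sgn ⟪d, ∇ f x⟫_ℝ) * max 1 (1 / γ) * (|⟪d, hessian f x d⟫_ℝ| / ‖d‖ ^ 3)) • d

/-- `NCGStep P f x x' G N`: an iteration of the method at `x`, with `‖∇f(x)‖ > εg`, can produce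
the next iterate `x'`, using `G` gradient evaluations (at `x` and, for a direction of type SOL,
at `x + d`) and `N` Hessian-vector products (those of the capped CG method and, for a direction of
type NC, the product `∇²f(x) d` for rescaling it). -/
inductive NCGStep {n : ℕ} (P : NCGInput) (f : E n → ℝ) (x : E n) : E n → ℕ → ℕ → Prop
  | solFull (d : E n) (N : ℕ) (hx : P.εg < ‖∇ f x‖)
      (hd : CappedCG (hessian f x) (∇ f x) (√(P.γ * P.εg)) P.ζ 0 DType.SOL d N)
      (hs : f (x + d) ≤ f x ∧ ‖∇ f (x + d)‖ ≤ P.εg) :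
      NCGStep P f x (x + d) 2 N
  | solSearch (d : E n) (N j : ℕ) (hx : P.εg < ‖∇ f x‖)
      (hd : CappedCG (hessian f x) (∇ f x) (√(P.γ * P.εg)) P.ζ 0 DType.SOL d N)
      (hs : ¬ (f (x + d) ≤ f x ∧ ‖∇ f (x + d)‖ ≤ P.εg))
      (hj : IsLeast {i : ℕ | f (x + P.θ ^ i • d) ≤
        f x - P.η * √(P.γ * P.εg) * P.θ ^ (2 * i) * ‖d‖ ^ 2} j) :
      NCGStep P f x (x + P.θ ^ j • d) 2 N
  | negCurv (d : E n) (N j : ℕ) (hx : P.εg < ‖∇ f x‖)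
      (hd : CappedCG (hessian f x) (∇ f x) (√(P.γ * P.εg)) P.ζ 0 DType.NC d N)
      (hj : IsLeast {i : ℕ | f (x + P.θ ^ i • ncDirection f P.γ x d) ≤
        f x - P.η * min 1 P.γ * P.θ ^ (2 * i) * ‖ncDirection f P.γ x d‖ ^ 3 / 4} j) :
      NCGStep P f x (x + P.θ ^ j • ncDirection f P.γ x d) 1 (N + 1)

/-- `NCGRun P f x₀ k x G N`: the method started at `x₀` can arrive at the beginning of iteration
`k` with `x^k = x`, after `G` gradient evaluations and `N` Hessian-vector products. -/
inductive NCGRun {n : ℕ} (P : NCGInput) (f : E n → ℝ) (x₀ : E n) : ℕ → E n → ℕ → ℕ → Prop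
  | start : NCGRun P f x₀ 0 x₀ 0 0
  | step {k : ℕ} {x x' : E n} {G N G' N' : ℕ} (hrun : NCGRun P f x₀ k x G N)
      (hstep : NCGStep P f x x' G' N') : NCGRun P f x₀ (k + 1) x' (G + G') (N + N')

/-- `NCGOutput P f x₀ k x G N`: the method can terminate in iteration `k` with output `x^k = x`,
after `G` gradient evaluations (the one at `x` included) and `N` Hessian-vector products. -/
def NCGOutput {n : ℕ} (P : NCGInput) (f : E n → ℝ) (x₀ : E n) (k : ℕ) (x : E n) (G N : ℕ) :
    Prop :=
  ‖∇ f x‖ ≤ P.εg ∧ ∃ G' : ℕ, G = G' + 1 ∧ NCGRun P f x₀ k x G' N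

/-! ### The constants -/

def cSol (ζ θ η : ℝ) : ℝ :=
  η * min ((2 / (4 + ζ + √((4 + ζ) ^ 2 + 1))) ^ 2) (1 / 6 * (2 * (1 - η) * θ / 3) ^ 2)

def cNc (θ η : ℝ) : ℝ := η * θ ^ 2 / 4

/-- `K₁ = ⌈ gap / min{c_sol, c_nc} · γ^{1/2} ε^{-3/2} ⌉ + 1`, where `gap = f(x⁰) - f_low ≥ 0`. -/
def K1 (P : NCGInput) (gap : ℝ) : ℕ :=
  ⌈gap / min (cSol P.ζ P.θ P.η) (cNc P.θ P.η) * √P.γ * P.εg ^ (-(3 / 2) : ℝ)⌉₊ + 1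

/-- The order `H_ν^{1/(1+ν)} ε^{-(2+ν)/(1+ν)}` of the number of iterations. -/
def iterOrder (ν Hν ε : ℝ) : ℝ := Hν ^ (1 / (1 + ν)) * ε ^ (-((2 + ν) / (1 + ν)))

/-- The quantity `U_H^{1/2} / (H_ν ε^ν)^{1/(2+2ν)}`. -/
def cgOrder (ν Hν UH ε : ℝ) : ℝ := √UH / (Hν * ε ^ ν) ^ (1 / (2 + 2 * ν))

end NewtonCG

end

/-! Everything is measured against the length `1/ρ`, where `ρ = (Hν/ε)^{1/(1+ν)}` is `invScale`. In
this unit `γ = 4ερ²`, the damping is `2ερ`, and the iteration order is `ρ/ε`. The Hölder error of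
the linear model of the gradient over a step `v` becomes `ε z^{1+ν}/(1+ν)` with `z = ρ‖v‖`. It is at
most `ε(z²+1)/2` always, and at most `εz` when `z ≤ 1`, so `ν` disappears from the rest of the
argument.

Decrease per iteration. If a trial step fails, then `f(x+td) + ct²` has an interior minimiser below
`f x`. That point lies in the level set, hence in `Ω`, and the slope of `f` there is `-2ct`.
Compared with the Taylor bound, this forces the critical step to have length above `1/ρ`, or, for
SOL directions, to be a fixed fraction of a full step that is itself long. Accepted steps therefore
have length at least a constant times `1/ρ`, and `f` drops by at least `D = min{c_sol, c_nc} ε/(2ρ)`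
(`IsSolDirection.decrease`, `nc_decrease`). The exception is a full SOL step to a point with small
gradient, after which the method stops. Dividing the gap by `D` gives `K1`.

Cost per iteration. As long as capped CG continues, its residuals are nonzero and orthogonal, so it
makes at most `n` passes. Residuals that are neither accurate nor slowly decaying also limit the
passes to `O(√κ log κ)`. The slow-decay exit always finds a direction of small curvature: if the
model were strongly convex between `y^{j+1}` and all earlier iterates, an estimating-sequence
argument in the style of accelerated gradient methods would give `‖r^j‖² ≤ 2κ τ^j ‖g‖²`, which slow
decay contradicts (`CGRegular.norm_r_sq_le`, `CGReaches.exists_negCurv`). -/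

namespace NewtonCG

open Filter Topology

/-! ### Taylor bounds and critical step lengths -/

section Calculus

variable {n : ℕ} {f : E n → ℝ}

lemma hasGradientAt_of_contDiff (hf : ContDiff ℝ 2 f) (x : E n) : HasGradientAt f (∇ f x) x :=
  ((hf.differentiable (by norm_num)) x).hasGradientAt

lemma contDiff_gradient (hf : ContDiff ℝ 2 f) : ContDiff ℝ 1 (fun y => ∇ f y) := by
  have h : ContDiff ℝ 1 (fderiv ℝ f) := hf.fderiv_right (by norm_num)
  exact (InnerProductSpace.toDual ℝ (E n)).symm.toContinuousLinearEquiv.contDiff.comp h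

lemma hasFDerivAt_gradient (hf : ContDiff ℝ 2 f) (x : E n) :
    HasFDerivAt (fun y => ∇ f y) (hessian f x) x :=
  ((contDiff_gradient hf).differentiable (by norm_num) x).hasFDerivAt

lemma hasDerivAt_line (x d : E n) (t : ℝ) : HasDerivAt (fun s : ℝ => x + s • d) d t := by
  simpa using ((hasDerivAt_id t).smul_const d).const_add x

lemma hasDerivAt_comp_line (hf : ContDiff ℝ 2 f) (x d : E n) (t : ℝ) :
    HasDerivAt (fun s : ℝ => f (x + s • d)) ⟪∇ f (x + t • d), d⟫_ℝ t := by
  have h := (hasGradientAt_of_contDiff hf (x + t • d)).hasFDerivAt.comp_hasDerivAt t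
    (hasDerivAt_line x d t)
  exact h.congr_deriv (by simp)

lemma hasDerivAt_gradient_line (hf : ContDiff ℝ 2 f) (x d : E n) (t : ℝ) :
    HasDerivAt (fun s : ℝ => ∇ f (x + s • d)) (hessian f (x + t • d) d) t :=
  HasFDerivAt.comp_hasDerivAt (l := fun y => ∇ f y) t (hasFDerivAt_gradient hf (x + t • d))
    (hasDerivAt_line x d t)

/-- Symmetry of the second derivative of a C² function, transported to the gradient by the Riesz
isomorphism. -/
lemma hessian_symm (hf : ContDiff ℝ 2 f) (x u v : E n) :
    ⟪hessian f x u, v⟫_ℝ = ⟪u, hessian f x v⟫_ℝ := by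
  have hs : IsSymmSndFDerivAt ℝ f x :=
    (hf.contDiffAt).isSymmSndFDerivAt (by simp)
  have h1 : HasFDerivAt (fderiv ℝ f) (fderiv ℝ (fderiv ℝ f) x) x :=
    ((hf.fderiv_right (m := 1) (by norm_num)).differentiable (by norm_num) x).hasFDerivAt
  have key : ∀ a b : E n, fderiv ℝ (fderiv ℝ f) x a b = ⟪hessian f x a, b⟫_ℝ := by
    intro a b
    have h2 : HasFDerivAt (fun y => fderiv ℝ f y b)
        ((ContinuousLinearMap.apply ℝ ℝ b).comp (fderiv ℝ (fderiv ℝ f) x)) x :=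
      (ContinuousLinearMap.apply ℝ ℝ b).hasFDerivAt.comp x h1
    have h3 : HasFDerivAt (fun y => ⟪∇ f y, b⟫_ℝ)
        ((innerSL ℝ b).comp (hessian f x)) x := by
      have := (innerSL ℝ b).hasFDerivAt.comp x (hasFDerivAt_gradient hf x)
      refine this.congr_of_eventuallyEq (Eventually.of_forall fun y => ?_)
      simp
    have h4 : (fun y => ⟪∇ f y, b⟫_ℝ) = fun y => fderiv ℝ f y b := by
      funext y
      have := (hasGradientAt_of_contDiff hf y).hasFDerivAt.fderiv
      rw [this]
      simp
    rw [h4] at h3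
    have := congrArg (fun l => l a) (h2.unique h3)
    simpa [real_inner_comm] using this
  rw [← key u v, hs.eq u v, key v u, real_inner_comm]

/-- The gradient vanishes at a point where `f` attains its minimum over the level set of `x₀`. -/
lemma gradient_eq_zero_of_le {x₀ x : E n} (hx : x ∈ levelSet f x₀)
    (h : ∀ y ∈ levelSet f x₀, f x ≤ f y) : ∇ f x = 0 := by
  have hmin : IsLocalMin f x := by
    refine Eventually.of_forall fun y => ?_
    by_cases hy : y ∈ levelSet f x₀
    · exact h y hy
    · have : f x₀ < f y := not_le.1 hy
      exact le_trans hx this.le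
  simp [gradient, hmin.fderiv_eq_zero]

/-- The error of the first-order model of the gradient under a Hölder condition on the Hessian. -/
lemma gradient_taylor {x₀ : E n} {ν Hν : ℝ} {Ω : Set (E n)} (h : HolderHessian f x₀ ν Hν Ω)
    {x y : E n} (hx : x ∈ Ω) (hy : y ∈ Ω) :
    ‖∇ f y - ∇ f x - hessian f x (y - x)‖ ≤ Hν / (1 + ν) * ‖y - x‖ ^ (1 + ν) := by
  have hν := h.exponent_mem.1
  set w := y - x with hw
  have hmem : ∀ t ∈ Set.Icc (0 : ℝ) 1, x + t • w ∈ Ω := fun t ht =>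
    h.convex.add_smul_sub_mem hx hy ht
  have hF : ∀ t : ℝ, HasDerivAt (fun s : ℝ => ∇ f (x + s • w) - ∇ f x - s • hessian f x w)
      (hessian f (x + t • w) w - hessian f x w) t := by
    intro t
    have := ((hasDerivAt_gradient_line h.contDiff x w t).sub_const (∇ f x)).sub
      ((hasDerivAt_id t).smul_const (hessian f x w))
    exact this.congr_deriv (by simp)
  -- Comparison function: its derivative dominates the norm of the derivative of the model error
  -- along the segment, which replaces integrating the Hölder bound.
  have hB : ∀ t : ℝ, HasDerivAt (fun s : ℝ => Hν * ‖w‖ ^ (1 + ν) / (1 + ν) * s ^ (1 + ν))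
      (Hν * ‖w‖ ^ (1 + ν) * t ^ ν) t := by
    intro t
    have := (Real.hasDerivAt_rpow_const (x := t) (p := 1 + ν) (Or.inr (by linarith))).const_mul
      (Hν * ‖w‖ ^ (1 + ν) / (1 + ν))
    have hne : (1 + ν) ≠ 0 := by linarith
    refine this.congr_deriv ?_
    rw [add_sub_cancel_left]
    field_simp
  have := image_norm_le_of_norm_deriv_right_le_deriv_boundary (a := 0) (b := 1)
    (fun t _ => (hF t).continuousAt.continuousWithinAt)
    (fun t _ => (hF t).hasDerivWithinAt) (by simp [Real.zero_rpow (by linarith : 1 + ν ≠ 0)])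
    hB (fun t ht => by
      have ht' : t ∈ Set.Icc (0 : ℝ) 1 := ⟨ht.1, ht.2.le⟩
      have h1 := h.holder _ (hmem t ht') _ hx
      rw [← sub_apply]
      refine (ContinuousLinearMap.le_opNorm _ _).trans ?_
      refine (mul_le_mul_of_nonneg_right h1 (norm_nonneg _)).trans (le_of_eq ?_)
      rw [add_sub_cancel_left, norm_smul, Real.norm_of_nonneg ht.1,
        Real.mul_rpow ht.1 (norm_nonneg _), add_comm 1 ν,
        Real.rpow_add_one' (norm_nonneg w) (by linarith)]
      ring) (Set.right_mem_Icc.2 zero_le_one)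
  simp only [one_smul, Real.one_rpow, mul_one] at this
  rw [hw, add_sub_cancel, ← hw] at this
  refine this.trans (le_of_eq (by ring))

/-- A step length at which sufficient decrease fails, along a direction that gives sufficient
decrease for small step lengths, exceeds a critical step length whose point lies in the level
set. -/
lemma exists_critical_step (hf : ContDiff ℝ 2 f) {x d : E n} {c b : ℝ} (hc : 0 ≤ c) (hb : 0 < b)
    (hsmall : ∀ᶠ t in 𝓝[>] (0 : ℝ), f (x + t • d) < f x - c * t ^ 2)
    (hfail : f x - c * b ^ 2 < f (x + b • d)) :
    ∃ t ∈ Set.Ioo 0 b, f (x + t • d) ≤ f x ∧ ⟪∇ f (x + t • d), d⟫_ℝ = -(2 * c * t) := by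
  set ψ : ℝ → ℝ := fun t => f (x + t • d) + c * t ^ 2 with hψ
  have hd : ∀ t, HasDerivAt ψ (⟪∇ f (x + t • d), d⟫_ℝ + 2 * c * t) t := by
    intro t
    have := (hasDerivAt_comp_line hf x d t).add ((hasDerivAt_pow 2 t).const_mul c)
    exact this.congr_deriv (by norm_num; ring)
  have hcont : Continuous ψ := continuous_iff_continuousAt.2 fun t => (hd t).continuousAt
  -- The minimum of `ψ` is below `ψ 0 = f x` by `hsmall`, while `ψ b > f x` by `hfail`; so the
  -- minimiser is interior.
  obtain ⟨t, ht, hmin⟩ := isCompact_Icc.exists_isMinOn (Set.nonempty_Icc.2 hb.le)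
    hcont.continuousOn
  obtain ⟨s, hs, hs0⟩ := (hsmall.and (Ioo_mem_nhdsGT hb)).exists
  have hts : ψ t < f x := lt_of_le_of_lt (hmin ⟨hs0.1.le, hs0.2.le⟩) (by simp only [hψ]; linarith)
  have ht0 : t ≠ 0 := by
    rintro rfl
    simp [hψ] at hts
  have htb : t ≠ b := by
    rintro rfl
    simp only [hψ] at hts
    linarith
  have ht' : t ∈ Set.Ioo 0 b := ⟨lt_of_le_of_ne ht.1 (Ne.symm ht0), lt_of_le_of_ne ht.2 htb⟩
  have hloc : IsLocalMin ψ t := hmin.isLocalMin (Icc_mem_nhds ht'.1 ht'.2)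
  have h0 := hloc.hasDerivAt_eq_zero (hd t)
  refine ⟨t, ht', ?_, by linarith⟩
  have : 0 ≤ c * t ^ 2 := by positivity
  simp only [hψ] at hts
  linarith

/-- Sufficient decrease for small step lengths from the sign of the derivative. -/
lemma eventually_decrease_of_deriv (hf : ContDiff ℝ 2 f) {x d : E n} {c : ℝ}
    (h : ∀ᶠ t in 𝓝[>] (0 : ℝ), ⟪∇ f (x + t • d), d⟫_ℝ + 2 * c * t < 0) :
    ∀ᶠ t in 𝓝[>] (0 : ℝ), f (x + t • d) < f x - c * t ^ 2 := by
  set ψ : ℝ → ℝ := fun t => f (x + t • d) + c * t ^ 2 with hψ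
  have hd : ∀ t, HasDerivAt ψ (⟪∇ f (x + t • d), d⟫_ℝ + 2 * c * t) t := by
    intro t
    have := (hasDerivAt_comp_line hf x d t).add ((hasDerivAt_pow 2 t).const_mul c)
    exact this.congr_deriv (by norm_num; ring)
  have hcont : Continuous ψ := continuous_iff_continuousAt.2 fun t => (hd t).continuousAt
  obtain ⟨b, hb, hI⟩ := mem_nhdsGT_iff_exists_Ioo_subset.1 h
  have hb' : (0 : ℝ) < b := hb
  have hanti : StrictAntiOn ψ (Set.Ico 0 b) := by
    refine strictAntiOn_of_deriv_neg (convex_Ico 0 b) hcont.continuousOn fun t ht => ?_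
    rw [interior_Ico] at ht
    rw [(hd t).deriv]
    exact hI ht
  filter_upwards [Ioo_mem_nhdsGT hb'] with t ht
  have := hanti ⟨le_refl _, hb'⟩ ⟨ht.1.le, ht.2⟩ ht.1
  simp only [hψ, zero_smul, add_zero] at this
  linarith

lemma eventually_decrease_of_descent (hf : ContDiff ℝ 2 f) {x d : E n} (c : ℝ)
    (h : ⟪∇ f x, d⟫_ℝ < 0) :
    ∀ᶠ t in 𝓝[>] (0 : ℝ), f (x + t • d) < f x - c * t ^ 2 := by
  refine eventually_decrease_of_deriv hf (Filter.Eventually.filter_mono nhdsWithin_le_nhds ?_)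
  have hc : ContinuousAt (fun t : ℝ => ⟪∇ f (x + t • d), d⟫_ℝ + 2 * c * t) 0 :=
    ((hasDerivAt_gradient_line hf x d 0).continuousAt.inner continuousAt_const).add
      (by fun_prop)
  exact hc.eventually_lt continuousAt_const (by simpa using h)

/-- The derivative of `f(x+td) + ct²` is nonpositive at `0` and has negative derivative there, so it
is negative just to the right of `0`. -/
lemma eventually_decrease_of_negCurv (hf : ContDiff ℝ 2 f) {x d : E n} {c : ℝ}
    (h : ⟪∇ f x, d⟫_ℝ ≤ 0) (h2 : ⟪d, hessian f x d⟫_ℝ + 2 * c < 0) :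
    ∀ᶠ t in 𝓝[>] (0 : ℝ), f (x + t • d) < f x - c * t ^ 2 := by
  refine eventually_decrease_of_deriv hf ?_
  have hd : HasDerivAt (fun t : ℝ => ⟪∇ f (x + t • d), d⟫_ℝ + 2 * c * t)
      (⟪d, hessian f x d⟫_ℝ + 2 * c) 0 := by
    have h1 := (hasDerivAt_gradient_line hf x d 0).inner ℝ (hasDerivAt_const (0 : ℝ) d)
    have := h1.add ((hasDerivAt_id (0 : ℝ)).const_mul (2 * c))
    exact this.congr_deriv (by simp [real_inner_comm])
  have hs := hd.tendsto_slope.eventually_lt (tendsto_const_nhds (x := (0 : ℝ))) h2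
  have hs' := hs.filter_mono (nhdsWithin_mono 0 (fun t (ht : 0 < t) => ne_of_gt ht))
  filter_upwards [hs', self_mem_nhdsWithin] with t ht ht0
  have ht0 : 0 < t := ht0
  rw [slope_def_field, div_neg_iff] at ht
  simp only [zero_smul, add_zero, mul_zero, sub_zero] at ht
  rcases ht with ht | ht <;> linarith [ht.1, ht.2]

end Calculus

/-! ### The conjugate gradient recurrence and its rate -/

section ConjugateGradients

variable {n : ℕ} {H : E n →L[ℝ] E n} {g : E n} {ε U₀ : ℝ}

lemma damped_symm (hH : ∀ u v, ⟪H u, v⟫_ℝ = ⟪u, H v⟫_ℝ) (u v : E n) :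
    ⟪damped H ε u, v⟫_ℝ = ⟪u, damped H ε v⟫_ℝ := by
  simp [damped, inner_add_left, inner_add_right, inner_smul_left, inner_smul_right, hH]

lemma cgState_succ_y (j : ℕ) : (cgState H g ε U₀ (j + 1)).y =
    (cgState H g ε U₀ j).y + cgAlpha H ε (cgState H g ε U₀ j) • (cgState H g ε U₀ j).p := rfl

lemma cgState_succ_r (j : ℕ) : (cgState H g ε U₀ (j + 1)).r =
    (cgState H g ε U₀ j).r +
      cgAlpha H ε (cgState H g ε U₀ j) • damped H ε (cgState H g ε U₀ j).p := rfl

lemma cgState_succ_p (j : ℕ) : (cgState H g ε U₀ (j + 1)).p =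
    -(cgState H g ε U₀ (j + 1)).r +
      (‖(cgState H g ε U₀ (j + 1)).r‖ ^ 2 / ‖(cgState H g ε U₀ j).r‖ ^ 2) •
        (cgState H g ε U₀ j).p := rfl

lemma cgState_r_eq (j : ℕ) :
    (cgState H g ε U₀ j).r = g + damped H ε (cgState H g ε U₀ j).y := by
  induction j with
  | zero => simp [cgState, cgInit]
  | succ j ih => rw [cgState_succ_r, cgState_succ_y, map_add, map_smul, ih, add_assoc]

lemma cgState_hv (j : ℕ) : (cgState H g ε U₀ j).hv = 1 + 3 * j := by
  induction j with
  | zero => rfl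
  | succ j ih =>
    change (cgState H g ε U₀ j).hv + 3 = _
    omega

/-- The first `j` steps of the conjugate gradient recurrence have nonzero residuals and
directions of positive curvature. -/
def CGRegular (H : E n →L[ℝ] E n) (g : E n) (ε U₀ : ℝ) (j : ℕ) : Prop :=
  ∀ i < j, (cgState H g ε U₀ i).r ≠ 0 ∧
    0 < ⟪(cgState H g ε U₀ i).p, damped H ε (cgState H g ε U₀ i).p⟫_ℝ

lemma CGRegular.mono {i j : ℕ} (h : CGRegular H g ε U₀ j) (hij : i ≤ j) :
    CGRegular H g ε U₀ i := fun l hl => h l (hl.trans_le hij)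

lemma CGRegular.alpha_pos {i j : ℕ} (h : CGRegular H g ε U₀ j) (hij : i < j) :
    0 < cgAlpha H ε (cgState H g ε U₀ i) := by
  obtain ⟨hr, hp⟩ := h i hij
  exact div_pos (real_inner_self_pos.2 hr) hp

lemma CGRegular.alpha_mul {i j : ℕ} (h : CGRegular H g ε U₀ j) (hij : i < j) :
    cgAlpha H ε (cgState H g ε U₀ i) *
      ⟪(cgState H g ε U₀ i).p, damped H ε (cgState H g ε U₀ i).p⟫_ℝ =
      ‖(cgState H g ε U₀ i).r‖ ^ 2 := by
  rw [cgAlpha, div_mul_cancel₀ _ (h i hij).2.ne', real_inner_self_eq_norm_sq]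

/-- A vector orthogonal to the directions `p⁰, …, p^l` is orthogonal to the residual `r^l`. -/
lemma inner_r_eq_zero {v : E n} {l : ℕ}
    (h : ∀ m ≤ l, ⟪v, (cgState H g ε U₀ m).p⟫_ℝ = 0) : ⟪v, (cgState H g ε U₀ l).r⟫_ℝ = 0 := by
  cases l with
  | zero => simpa [cgState, cgInit] using h 0 le_rfl
  | succ l =>
    have h1 := h (l + 1) le_rfl
    rw [cgState_succ_p, inner_add_right, inner_smul_right, h l (by omega), inner_neg_right] at h1
    linarith

/-- The orthogonality relations of the conjugate gradient method. -/
lemma CGRegular.orthogonality (hH : ∀ u v, ⟪H u, v⟫_ℝ = ⟪u, H v⟫_ℝ) {i : ℕ}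
    (h : CGRegular H g ε U₀ i) :
    ⟪(cgState H g ε U₀ i).r, (cgState H g ε U₀ i).p⟫_ℝ = -‖(cgState H g ε U₀ i).r‖ ^ 2 ∧
    ∀ l < i, ⟪(cgState H g ε U₀ i).r, (cgState H g ε U₀ l).p⟫_ℝ = 0 ∧
      ⟪(cgState H g ε U₀ i).p, damped H ε (cgState H g ε U₀ l).p⟫_ℝ = 0 := by
  induction i with
  | zero => simp [cgState, cgInit]
  | succ i ih =>
    obtain ⟨ih1, ih2⟩ := ih (h.mono (Nat.le_succ i))
    have hrp : ∀ l ≤ i, ⟪(cgState H g ε U₀ (i + 1)).r, (cgState H g ε U₀ l).p⟫_ℝ = 0 := by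
      intro l hl
      rw [cgState_succ_r, inner_add_left, real_inner_smul_left, damped_symm hH]
      rcases hl.lt_or_eq with hl | rfl
      · rw [(ih2 l hl).1, (ih2 l hl).2, mul_zero, add_zero]
      · rw [ih1, h.alpha_mul (Nat.lt_succ_self l)]
        ring
    have hrr : ∀ l ≤ i, ⟪(cgState H g ε U₀ (i + 1)).r, (cgState H g ε U₀ l).r⟫_ℝ = 0 :=
      fun l hl => inner_r_eq_zero fun m hm => hrp m (hm.trans hl)
    refine ⟨?_, fun l hl => ⟨hrp l (by omega), ?_⟩⟩
    · rw [cgState_succ_p, inner_add_right, inner_smul_right, hrp i le_rfl, inner_neg_right,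
        real_inner_self_eq_norm_sq]
      ring
    -- `α_l H̄ p^l = r^{l+1} - r^l` reduces conjugacy to orthogonality of residuals. For `l < i`
    -- both terms vanish; for `l = i` the choice of `β` makes them cancel.
    · have hα := h.alpha_pos hl
      have h1 := cgState_succ_r (H := H) (g := g) (ε := ε) (U₀ := U₀) l
      have h2 : cgAlpha H ε (cgState H g ε U₀ l) *
          ⟪(cgState H g ε U₀ (i + 1)).r, damped H ε (cgState H g ε U₀ l).p⟫_ℝ =
          ⟪(cgState H g ε U₀ (i + 1)).r, (cgState H g ε U₀ (l + 1)).r⟫_ℝ := by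
        rw [h1, inner_add_right, inner_smul_right, hrr l (by omega), zero_add]
      rw [cgState_succ_p, inner_add_left, real_inner_smul_left, inner_neg_left]
      rcases (Nat.lt_succ_iff.1 hl).lt_or_eq with hl' | rfl
      · rw [hrr (l + 1) hl', mul_eq_zero] at h2
        rw [h2.resolve_left hα.ne', (ih2 l hl').2]
        ring
      · have h3 := h.alpha_mul hl
        have hr : 0 < ‖(cgState H g ε U₀ l).r‖ ^ 2 := by
          have := norm_pos_iff.2 (h l hl).1
          positivity
        rw [real_inner_self_eq_norm_sq] at h2
        rw [div_mul_eq_mul_div, neg_add_eq_zero, eq_div_iff hr.ne', ← h2, ← h3]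
        ring

lemma CGRegular.inner_r_r (hH : ∀ u v, ⟪H u, v⟫_ℝ = ⟪u, H v⟫_ℝ) {i l : ℕ}
    (h : CGRegular H g ε U₀ i) (hl : l < i) :
    ⟪(cgState H g ε U₀ i).r, (cgState H g ε U₀ l).r⟫_ℝ = 0 :=
  inner_r_eq_zero fun m hm => ((h.orthogonality hH).2 m (by omega)).1

lemma CGRegular.inner_r_y (hH : ∀ u v, ⟪H u, v⟫_ℝ = ⟪u, H v⟫_ℝ) {i : ℕ}
    (h : CGRegular H g ε U₀ i) {l : ℕ} (hl : l ≤ i) :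
    ⟪(cgState H g ε U₀ i).r, (cgState H g ε U₀ l).y⟫_ℝ = 0 := by
  induction l with
  | zero => simp [cgState, cgInit]
  | succ l ih =>
    rw [cgState_succ_y, inner_add_right, inner_smul_right, ih (by omega),
      ((h.orthogonality hH).2 l (by omega)).1]
    ring

/-- The curvature along a direction is at most that along the residual. -/
lemma CGRegular.curv_p_le (hH : ∀ u v, ⟪H u, v⟫_ℝ = ⟪u, H v⟫_ℝ) {i : ℕ}
    (h : CGRegular H g ε U₀ i) :
    ⟪(cgState H g ε U₀ i).p, damped H ε (cgState H g ε U₀ i).p⟫_ℝ ≤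
      ⟪(cgState H g ε U₀ i).r, damped H ε (cgState H g ε U₀ i).r⟫_ℝ := by
  cases i with
  | zero => simp [cgState, cgInit]
  | succ i =>
    have h1 := ((h.orthogonality hH).2 i (Nat.lt_succ_self i)).2
    have h1' : ⟪(cgState H g ε U₀ i).p, damped H ε (cgState H g ε U₀ (i + 1)).p⟫_ℝ = 0 := by
      rw [← damped_symm hH, real_inner_comm, h1]
    have h2 := (h i (Nat.lt_succ_self i)).2
    set β := ‖(cgState H g ε U₀ (i + 1)).r‖ ^ 2 / ‖(cgState H g ε U₀ i).r‖ ^ 2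
    -- By conjugacy the curvature along `r^{i+1}` is the sum of those along `β p^i` and `p^{i+1}`;
    -- the first is nonnegative.
    have h3 : (cgState H g ε U₀ (i + 1)).r =
        β • (cgState H g ε U₀ i).p - (cgState H g ε U₀ (i + 1)).p := by
      rw [cgState_succ_p]
      simp [β]
    rw [h3, map_sub, map_smul, inner_sub_left, inner_sub_right, inner_sub_right,
      real_inner_smul_left, real_inner_smul_left, inner_smul_right, inner_smul_right, h1, h1']
    nlinarith [mul_nonneg (mul_self_nonneg β) h2.le]

/-- A regular run of `j` steps needs `j` dimensions. -/
lemma CGRegular.le_dim (hH : ∀ u v, ⟪H u, v⟫_ℝ = ⟪u, H v⟫_ℝ) {j : ℕ}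
    (h : CGRegular H g ε U₀ j) : j ≤ n := by
  have hli : LinearIndependent ℝ (fun i : Fin j => (cgState H g ε U₀ i).r) := by
    refine linearIndependent_of_ne_zero_of_inner_eq_zero (fun i => (h i i.2).1) ?_
    intro a b hab
    rcases lt_or_gt_of_ne hab with hlt | hlt
    · rw [real_inner_comm]
      exact (h.mono b.2.le).inner_r_r hH hlt
    · exact (h.mono a.2.le).inner_r_r hH hlt
  simpa using hli.fintype_card_le_finrank

/-- The quadratic model `½ yᵀ H̄ y + gᵀ y`. -/
noncomputable def model (H : E n →L[ℝ] E n) (g : E n) (ε : ℝ) (y : E n) : ℝ :=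
  1 / 2 * ⟪y, damped H ε y⟫_ℝ + ⟪g, y⟫_ℝ

lemma model_add (hH : ∀ u v, ⟪H u, v⟫_ℝ = ⟪u, H v⟫_ℝ) (y v : E n) :
    model H g ε (y + v) = model H g ε y + ⟪g + damped H ε y, v⟫_ℝ +
      1 / 2 * ⟪v, damped H ε v⟫_ℝ := by
  simp only [model, map_add, inner_add_left, inner_add_right]
  rw [← damped_symm hH v y, real_inner_comm y (damped H ε v), damped_symm hH y v]
  ring

lemma CGRegular.model_succ (hH : ∀ u v, ⟪H u, v⟫_ℝ = ⟪u, H v⟫_ℝ) {i : ℕ}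
    (h : CGRegular H g ε U₀ (i + 1)) :
    model H g ε (cgState H g ε U₀ (i + 1)).y = model H g ε (cgState H g ε U₀ i).y -
      1 / 2 * (cgAlpha H ε (cgState H g ε U₀ i) * ‖(cgState H g ε U₀ i).r‖ ^ 2) := by
  rw [cgState_succ_y, model_add hH, ← cgState_r_eq, map_smul, inner_smul_right,
    real_inner_smul_left, inner_smul_right, h.alpha_mul (Nat.lt_succ_self i),
    ((h.mono (Nat.le_succ i)).orthogonality hH).1]
  ring

/-- The step lowers the model by `α‖r‖²/2`, and `α ≥ 1/L` because the curvature along `p` is at most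
that along `r`. -/
lemma CGRegular.model_decrease (hH : ∀ u v, ⟪H u, v⟫_ℝ = ⟪u, H v⟫_ℝ) {i : ℕ}
    (h : CGRegular H g ε U₀ (i + 1)) {L : ℝ}
    (hL : ⟪(cgState H g ε U₀ i).r, damped H ε (cgState H g ε U₀ i).r⟫_ℝ ≤
      L * ‖(cgState H g ε U₀ i).r‖ ^ 2) :
    ‖(cgState H g ε U₀ i).r‖ ^ 2 ≤ 2 * L * (model H g ε (cgState H g ε U₀ i).y -
      model H g ε (cgState H g ε U₀ (i + 1)).y) := by
  have h1 := h.alpha_mul (Nat.lt_succ_self i)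
  have h2 := (h.mono (Nat.le_succ i)).curv_p_le hH
  have h3 := h.alpha_pos (Nat.lt_succ_self i)
  rw [h.model_succ hH]
  nlinarith [mul_le_mul_of_nonneg_left (h2.trans hL) h3.le]

/-- The centres of the estimating quadratics. -/
noncomputable def estCentre (H : E n →L[ℝ] E n) (g : E n) (ε U₀ m τ : ℝ) : ℕ → E n
  | 0 => 0
  | i + 1 => τ • estCentre H g ε U₀ m τ i +
      (1 - τ) • ((cgState H g ε U₀ i).y - m⁻¹ • (cgState H g ε U₀ i).r)

/-- The centres are combinations of earlier iterates and residuals, all orthogonal to the current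
residual. This is why plain CG can follow the accelerated analysis without an extrapolation step. -/
lemma CGRegular.inner_r_estCentre (hH : ∀ u v, ⟪H u, v⟫_ℝ = ⟪u, H v⟫_ℝ) {i : ℕ}
    (h : CGRegular H g ε U₀ i) (m τ : ℝ) {l : ℕ} (hl : l ≤ i) :
    ⟪(cgState H g ε U₀ i).r, estCentre H g ε U₀ m τ l⟫_ℝ = 0 := by
  induction l with
  | zero => simp [estCentre]
  | succ l ih =>
    rw [estCentre, inner_add_right, inner_smul_right, inner_smul_right, inner_sub_right,
      inner_smul_right, ih (by omega), h.inner_r_y hH (by omega : l ≤ i),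
      h.inner_r_r hH (by omega : l < i)]
    ring

/-- Decrease of the squared distance to `w` under the update of the centres. -/
lemma estCentre_dist_le {v y r w : E n} {m τ : ℝ} (hm : 0 < m) (hτ : τ ∈ Set.Icc (0 : ℝ) 1)
    (hv : ⟪r, v⟫_ℝ = 0) (hy : ⟪r, y⟫_ℝ = 0) :
    m / 2 * ‖τ • v + (1 - τ) • (y - m⁻¹ • r) - w‖ ^ 2 ≤
      τ * (m / 2 * ‖v - w‖ ^ 2) + (1 - τ) * (m / 2 * ‖w - y‖ ^ 2 + ⟪r, w - y⟫_ℝ) +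
        (1 - τ) ^ 2 / (2 * m) * ‖r‖ ^ 2 := by
  have hyw := sq_nonneg ‖v - y‖
  simp only [← real_inner_self_eq_norm_sq, inner_add_left, inner_add_right, inner_sub_left,
    inner_sub_right, real_inner_smul_left, inner_smul_right, real_inner_comm r v,
    real_inner_comm r y, hv, hy, real_inner_comm v y, real_inner_comm v w, real_inner_comm y w,
    real_inner_comm r w] at hyw ⊢
  -- Coefficient of `‖v - y‖²`, the term dropped when the square of the convex combination is
  -- expanded.
  have h1 : 0 ≤ τ * (1 - τ) * (m / 2) := by
    have := sub_nonneg.2 hτ.2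
    have := hτ.1
    positivity
  have h2 := mul_nonneg h1 hyw
  have h3 : m * m⁻¹ = 1 := mul_inv_cancel₀ hm.ne'
  have h4 : (1 - τ) ^ 2 / (2 * m) = (1 - τ) ^ 2 * m⁻¹ / 2 := by
    field_simp
  rw [h4]
  linear_combination (exp := 1) h2 + ((1 - τ) ^ 2 / 2 * m⁻¹ * ⟪r, r⟫_ℝ + (1 - τ) * ⟪r, w⟫_ℝ) * h3

/-- Geometric decrease of the residual, if the model is strongly convex between the next iterate
and the previous ones. -/
lemma CGRegular.norm_r_sq_le (hH : ∀ u v, ⟪H u, v⟫_ℝ = ⟪u, H v⟫_ℝ) {j : ℕ} (hj : 0 < j)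
    (h : CGRegular H g ε U₀ (j + 1)) {m L τ : ℝ} (hm : 0 < m) (hL : 0 < L)
    (hτ : τ ∈ Set.Icc (0 : ℝ) 1) (hLm : L * (1 - τ) ^ 2 ≤ m)
    (hr : ∀ i ≤ j, ⟪(cgState H g ε U₀ i).r, damped H ε (cgState H g ε U₀ i).r⟫_ℝ ≤
      L * ‖(cgState H g ε U₀ i).r‖ ^ 2)
    (hc : ∀ i < j, m * ‖(cgState H g ε U₀ (j + 1)).y - (cgState H g ε U₀ i).y‖ ^ 2 ≤
      ⟪(cgState H g ε U₀ (j + 1)).y - (cgState H g ε U₀ i).y,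
        damped H ε ((cgState H g ε U₀ (j + 1)).y - (cgState H g ε U₀ i).y)⟫_ℝ) :
    ‖(cgState H g ε U₀ j).r‖ ^ 2 ≤ 2 * (L / m) * τ ^ j * ‖g‖ ^ 2 := by
  set w := (cgState H g ε U₀ (j + 1)).y with hw
  -- Lyapunov function: model gap to `w` plus scaled distance from the centre to `w`, contracted by
  -- `τ` at each step.
  have hV : ∀ i ≤ j, model H g ε (cgState H g ε U₀ i).y - model H g ε w +
      m / 2 * ‖estCentre H g ε U₀ m τ i - w‖ ^ 2 ≤ τ ^ i * (‖g‖ ^ 2 / m) := by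
    intro i
    induction i with
    | zero =>
      intro _
      have h1 := hc 0 hj
      have h2 := model_add (g := g) (ε := ε) hH 0 w
      -- At `w = y^{j+1}` the residual is orthogonal to `w`, so `⟪g, w⟫ = -⟪w, H̄ w⟫`. Strong
      -- convexity then gives `m‖w‖ ≤ ‖g‖`.
      have h3 := h.inner_r_y hH le_rfl
      rw [cgState_r_eq, inner_add_left, damped_symm hH, ← hw] at h3
      simp only [cgState, cgInit, estCentre, sub_zero, zero_sub, norm_neg, map_zero, add_zero,
        zero_add] at h1 h2 ⊢
      rw [h2]
      have h4 := abs_le.1 (abs_real_inner_le_norm g w)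
      have h5 : m * ‖w‖ ≤ ‖g‖ := by
        rcases (norm_nonneg w).eq_or_lt with h0 | h0
        · rw [← h0, mul_zero]
          exact norm_nonneg g
        · refine le_of_mul_le_mul_right ?_ h0
          linarith [h4.1, sq ‖w‖]
      have h6 : ‖g‖ * ‖w‖ ≤ ‖g‖ ^ 2 / m := by
        rw [le_div_iff₀ hm]
        nlinarith [mul_le_mul_of_nonneg_left h5 (norm_nonneg g)]
      rw [pow_zero, one_mul]
      linarith [h4.1]
    | succ i ih =>
      intro hi
      have h0 := ih (by omega)
      have hreg : CGRegular H g ε U₀ (i + 1) := h.mono (by omega)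
      have hreg' : CGRegular H g ε U₀ i := h.mono (by omega)
      have h1 := estCentre_dist_le (w := w) hm hτ
        (hreg'.inner_r_estCentre hH m τ le_rfl) (hreg'.inner_r_y hH le_rfl)
      have h2 := model_add (g := g) (ε := ε) hH (cgState H g ε U₀ i).y
        (w - (cgState H g ε U₀ i).y)
      rw [add_sub_cancel, ← cgState_r_eq] at h2
      have h3 := hc i (by omega)
      have h4 := hreg.model_decrease hH (hr i (by omega))
      have h5 : (1 - τ) ^ 2 / (2 * m) * ‖(cgState H g ε U₀ i).r‖ ^ 2 ≤
          model H g ε (cgState H g ε U₀ i).y - model H g ε (cgState H g ε U₀ (i + 1)).y := by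
        have h6 : 0 ≤ model H g ε (cgState H g ε U₀ i).y -
            model H g ε (cgState H g ε U₀ (i + 1)).y := by
          have := (sq_nonneg ‖(cgState H g ε U₀ i).r‖).trans h4
          exact nonneg_of_mul_nonneg_right this (by positivity)
        rw [div_mul_eq_mul_div, div_le_iff₀ (by positivity)]
        nlinarith [mul_le_mul_of_nonneg_left h4 (sq_nonneg (1 - τ)),
          mul_le_mul_of_nonneg_right hLm h6]
      have h7 := mul_le_mul_of_nonneg_left h0 hτ.1
      have h8 : (1 - τ) * (m / 2 * ‖w - (cgState H g ε U₀ i).y‖ ^ 2 +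
          ⟪(cgState H g ε U₀ i).r, w - (cgState H g ε U₀ i).y⟫_ℝ) ≤
          (1 - τ) * (model H g ε w - model H g ε (cgState H g ε U₀ i).y) :=
        mul_le_mul_of_nonneg_left (by linarith) (sub_nonneg.2 hτ.2)
      rw [estCentre, pow_succ' τ i, mul_assoc]
      linarith
  have h1 := h.model_decrease hH (hr j le_rfl)
  have h2 := hV j le_rfl
  have h3 : 0 ≤ m / 2 * ‖estCentre H g ε U₀ m τ j - w‖ ^ 2 := by positivity
  calc ‖(cgState H g ε U₀ j).r‖ ^ 2 ≤ 2 * L * (τ ^ j * (‖g‖ ^ 2 / m)) := by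
        refine h1.trans (mul_le_mul_of_nonneg_left ?_ (by positivity))
        linarith
    _ = 2 * (L / m) * τ ^ j * ‖g‖ ^ 2 := by
        field_simp

end ConjugateGradients

/-! ### Termination and output of capped CG -/

section CappedMethod

variable {n : ℕ} {H : E n →L[ℝ] E n} {g : E n} {ε ζ U₀ : ℝ}

lemma le_raiseU (U : ℝ) (v : E n) : U ≤ raiseU H U v := by
  unfold raiseU
  split_ifs with h
  · have hv : 0 < ‖v‖ := by
      refine norm_pos_iff.2 ?_
      rintro rfl
      simp at h
    exact (le_div_iff₀ hv).2 h.le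
  · exact le_rfl

lemma norm_le_raiseU (U : ℝ) (v : E n) : ‖H v‖ ≤ raiseU H U v * ‖v‖ := by
  unfold raiseU
  split_ifs with h
  · by_cases hv : v = 0
    · simp [hv]
    · rw [div_mul_cancel₀ _ (norm_ne_zero_iff.2 hv)]
  · exact not_lt.1 h

lemma raiseU_le {U B : ℝ} (v : E n) (hU : U ≤ B) (hB : ‖H‖ ≤ B) : raiseU H U v ≤ B := by
  unfold raiseU
  split_ifs with h
  · exact (H.ratio_le_opNorm v).trans hB
  · exact hU

lemma cgState_U_mono {i j : ℕ} (hij : i ≤ j) :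
    (cgState H g ε U₀ i).U ≤ (cgState H g ε U₀ j).U :=
  monotone_nat_of_le_succ (f := fun j => (cgState H g ε U₀ j).U)
    (fun _ => ((le_raiseU _ _).trans (le_raiseU _ _)).trans (le_raiseU _ _)) hij

lemma le_cgState_U (j : ℕ) : U₀ ≤ (cgState H g ε U₀ j).U :=
  (le_raiseU U₀ (-g)).trans (cgState_U_mono (Nat.zero_le j))

lemma cgState_U_le {B : ℝ} (hU : U₀ ≤ B) (hB : ‖H‖ ≤ B) (j : ℕ) :
    (cgState H g ε U₀ j).U ≤ B := by
  induction j with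
  | zero => exact raiseU_le _ hU hB
  | succ j ih => exact raiseU_le _ (raiseU_le _ (raiseU_le _ ih hB) hB) hB

/-- `U` need not bound `‖H‖`. The analysis uses it only on the residuals and iterates, where the
updates enforce the bound. -/
lemma norm_H_r_le (j : ℕ) : ‖H (cgState H g ε U₀ j).r‖ ≤
    (cgState H g ε U₀ j).U * ‖(cgState H g ε U₀ j).r‖ := by
  cases j with
  | zero =>
    have := norm_le_raiseU (H := H) U₀ (-g)
    simpa [cgState, cgInit] using this
  | succ j => exact norm_le_raiseU _ _

lemma norm_H_y_le (j : ℕ) : ‖H (cgState H g ε U₀ j).y‖ ≤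
    (cgState H g ε U₀ j).U * ‖(cgState H g ε U₀ j).y‖ := by
  cases j with
  | zero => simp [cgState, cgInit]
  | succ j =>
    exact (norm_le_raiseU (raiseU H (cgState H g ε U₀ j).U _) _).trans
      (mul_le_mul_of_nonneg_right (le_raiseU _ _) (norm_nonneg _))

lemma norm_damped_le {v : E n} {U : ℝ} (hε : 0 < ε) (h : ‖H v‖ ≤ U * ‖v‖) :
    ‖damped H ε v‖ ≤ (U + 2 * ε) * ‖v‖ := by
  have : damped H ε v = H v + (2 * ε) • v := by simp [damped]
  rw [this]
  refine (norm_add_le _ _).trans ?_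
  rw [norm_smul, Real.norm_of_nonneg (by positivity)]
  linarith

lemma two_le_kappa (hε : 0 < ε) {U : ℝ} (hU : 0 ≤ U) : 2 ≤ kappa ε U := by
  rw [kappa, le_div_iff₀ hε]
  linarith

lemma kappa_mono (hε : 0 < ε) {U V : ℝ} (h : U ≤ V) : kappa ε U ≤ kappa ε V := by
  unfold kappa
  gcongr

lemma tau_mem (ε U : ℝ) : tau ε U ∈ Set.Ico (0 : ℝ) 1 := by
  have := Real.sqrt_nonneg (kappa ε U)
  refine ⟨by unfold tau; positivity, ?_⟩
  rw [tau, div_lt_one (by positivity)]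
  linarith

/-- Since `1 - τ = 1/(√κ+1)`. This is the condition `L(1-τ)² ≤ m` of the rate estimate, with `L =
κε` and `m = ε`. -/
lemma kappa_mul_tau_le {U : ℝ} (h : 0 ≤ kappa ε U) :
    kappa ε U * (1 - tau ε U) ^ 2 ≤ 1 := by
  have h0 := Real.sqrt_nonneg (kappa ε U)
  have h1 := Real.sq_sqrt h
  have h2 : 1 - tau ε U = 1 / (√(kappa ε U) + 1) := by
    rw [tau]
    field_simp
    ring
  rw [h2, div_pow, one_pow, mul_one_div, div_le_one (by positivity)]
  nlinarith

lemma two_kappa_le_bigT (hε : 0 < ε) {U : ℝ} (hU : 0 ≤ U) :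
    2 * kappa ε U ≤ bigT ε U := by
  have hk := two_le_kappa hε hU
  obtain ⟨h0, h1⟩ := tau_mem ε U
  have h2 : √(tau ε U) < 1 := by rw [Real.sqrt_lt' one_pos]; simpa using h1
  have h3 := Real.sqrt_nonneg (tau ε U)
  have h4 : (1 - √(tau ε U)) ^ 2 ≤ 1 := by nlinarith
  have h5 : 0 < (1 - √(tau ε U)) ^ 2 := by
    have : 0 < 1 - √(tau ε U) := by linarith
    positivity
  rw [bigT, le_div_iff₀ h5]
  have h6 : 2 * kappa ε U ≤ 4 * kappa ε U ^ 4 := by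
    have : 1 ≤ kappa ε U ^ 3 := one_le_pow₀ (by linarith)
    nlinarith
  calc 2 * kappa ε U * (1 - √(tau ε U)) ^ 2 ≤ 2 * kappa ε U * 1 := by gcongr
    _ ≤ _ := by linarith

lemma bigT_nonneg (ε U : ℝ) : 0 ≤ bigT ε U := by
  unfold bigT
  positivity

/-- `⟪r, p⟫ = -‖r‖²` makes `p` nonzero, so failing the curvature test yields strictly positive
curvature. -/
lemma CGRegular.succ (hH : ∀ u v, ⟪H u, v⟫_ℝ = ⟪u, H v⟫_ℝ) (hε : 0 < ε) {j : ℕ}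
    (h : CGRegular H g ε U₀ j) (hr : (cgState H g ε U₀ j).r ≠ 0)
    (hp : ¬ NegCurv H ε (cgState H g ε U₀ j).p) : CGRegular H g ε U₀ (j + 1) := by
  intro i hi
  rcases (Nat.lt_succ_iff.1 hi).lt_or_eq with hi | rfl
  · exact h i hi
  · refine ⟨hr, lt_of_lt_of_le ?_ (not_lt.1 hp)⟩
    have h1 := (h.orthogonality hH).1
    have h2 : (cgState H g ε U₀ i).p ≠ 0 := by
      intro h0
      rw [h0, inner_zero_right, zero_eq_neg] at h1
      exact hr (norm_eq_zero.1 (pow_eq_zero_iff (two_ne_zero)|>.1 h1))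
    have := norm_pos_iff.2 h2
    positivity

lemma r_ne_zero_of_not_accurate (hε : 0 < ε) (hζ : 0 < ζ) (hU : 0 ≤ U₀) {j : ℕ}
    (h : ¬ Accurate g ε ζ (cgState H g ε U₀ j)) : (cgState H g ε U₀ j).r ≠ 0 := by
  intro h0
  apply h
  have := two_le_kappa hε (hU.trans (le_cgState_U (H := H) (g := g) (ε := ε) j))
  rw [Accurate, h0, norm_zero, zetaHat]
  positivity

lemma CGReaches.regular (hH : ∀ u v, ⟪H u, v⟫_ℝ = ⟪u, H v⟫_ℝ) (hε : 0 < ε) (hζ : 0 < ζ)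
    (hU : 0 ≤ U₀) (hg : g ≠ 0) {j : ℕ} (h : CGReaches H g ε ζ U₀ j) :
    CGRegular H g ε U₀ j := by
  obtain ⟨-, h0, h1⟩ := h
  induction j with
  | zero => exact fun i hi => absurd hi (Nat.not_lt_zero i)
  | succ j ih =>
    refine (ih fun i hi hij => h1 i hi (by omega)).succ hH hε ?_ ?_
    · cases j with
      | zero => simpa [cgState, cgInit] using hg
      | succ j => exact r_ne_zero_of_not_accurate hε hζ hU (h1 (j + 1) (by omega) (by omega)).2.1
    · cases j with
      | zero => exact h0
      | succ j => exact (h1 (j + 1) (by omega) (by omega)).2.2.1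

/-- Slow decay of the residual reveals a direction of small curvature. -/
lemma CGReaches.exists_negCurv (hH : ∀ u v, ⟪H u, v⟫_ℝ = ⟪u, H v⟫_ℝ) (hε : 0 < ε)
    (hζ : 0 < ζ) (hU : 0 ≤ U₀) (hg : g ≠ 0) {j : ℕ} (h : CGReaches H g ε ζ U₀ j)
    (h2 : ¬ Accurate g ε ζ (cgState H g ε U₀ j)) (h3 : ¬ NegCurv H ε (cgState H g ε U₀ j).p)
    (h4 : SlowDecay g ε j (cgState H g ε U₀ j)) :
    ∃ i < j, NegCurv H ε (cgNextY H ε (cgState H g ε U₀ j) - (cgState H g ε U₀ i).y) := by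
  by_contra! hcon
  have hreg := (h.regular hH hε hζ hU hg).succ hH hε (r_ne_zero_of_not_accurate hε hζ hU h2) h3
  set U := (cgState H g ε U₀ j).U with hUdef
  have hU' : 0 ≤ U := hU.trans (le_cgState_U j)
  have hk := two_le_kappa hε hU'
  have hkε : kappa ε U * ε = U + 2 * ε := by
    rw [kappa]
    field_simp
  obtain ⟨ht0, ht1⟩ := tau_mem ε U
  -- `U` only grows, so its value at pass `j` serves for all earlier residuals.
  have hle := hreg.norm_r_sq_le hH h.1 (m := ε) (L := kappa ε U * ε) (τ := tau ε U) hε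
    (by positivity) ⟨ht0, ht1.le⟩
    (by nlinarith [kappa_mul_tau_le (ε := ε) (U := U) (by linarith)])
    (fun i hi => by
      have h5 := norm_damped_le hε ((norm_H_r_le (H := H) (g := g) (ε := ε) (U₀ := U₀) i).trans
        (mul_le_mul_of_nonneg_right (cgState_U_mono hi) (norm_nonneg _)))
      rw [hkε]
      refine (real_inner_le_norm _ _).trans ?_
      nlinarith [mul_le_mul_of_nonneg_left h5 (norm_nonneg (cgState H g ε U₀ i).r)])
    (fun i hi => not_lt.1 (hcon i hi))
  rw [mul_div_cancel_right₀ _ hε.ne'] at hle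
  rw [SlowDecay, ← hUdef, gt_iff_lt] at h4
  have hsq := pow_lt_pow_left₀ h4 (by positivity) two_ne_zero
  have hpow : (tau ε U ^ ((j : ℝ) / 2)) ^ 2 = tau ε U ^ j := by
    rw [← Real.rpow_natCast, ← Real.rpow_mul ht0, ← Real.rpow_natCast]
    congr 1
    push_cast
    ring
  rw [mul_pow, mul_pow, Real.sq_sqrt (bigT_nonneg ε U), hpow] at hsq
  have := two_kappa_le_bigT hε hU'
  have h7 : 2 * kappa ε U * tau ε U ^ j * ‖g‖ ^ 2 ≤ bigT ε U * tau ε U ^ j * ‖g‖ ^ 2 := by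
    gcongr
  linarith

/-- The capped conjugate gradient method returns a direction. -/
lemma exists_cappedCG (hH : ∀ u v, ⟪H u, v⟫_ℝ = ⟪u, H v⟫_ℝ) (hε : 0 < ε)
    (hζ : 0 < ζ) (hU : 0 ≤ U₀) (hg : g ≠ 0) :
    ∃ t d N, CappedCG H g ε ζ U₀ t d N := by
  by_contra! hcon
  have h0 : ¬ NegCurv H ε (-g) := fun h => hcon _ _ _ (CappedCG.initial h)
  have hall : ∀ j, CGReaches H g ε ζ U₀ (j + 1) := by
    intro j
    induction j with
    | zero => exact ⟨le_rfl, h0, fun i hi hij => by omega⟩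
    | succ j ih =>
      refine ⟨by omega, h0, fun i hi hij => ?_⟩
      rcases (Nat.lt_succ_iff.1 hij).lt_or_eq with hij | rfl
      · exact ih.2.2 i hi hij
      have h1 : ¬ NegCurv H ε (cgState H g ε U₀ (j + 1)).y :=
        fun h => hcon _ _ _ (CappedCG.curvY _ ih h)
      have h2 : ¬ Accurate g ε ζ (cgState H g ε U₀ (j + 1)) :=
        fun h => hcon _ _ _ (CappedCG.solution _ ih h1 h)
      have h3 : ¬ NegCurv H ε (cgState H g ε U₀ (j + 1)).p :=
        fun h => hcon _ _ _ (CappedCG.curvP _ ih h1 h2 h)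
      refine ⟨h1, h2, h3, fun h4 => ?_⟩
      obtain ⟨i, hi, h5⟩ := ih.exists_negCurv hH hε hζ hU hg h2 h3 h4
      exact hcon _ _ _ (CappedCG.slow _ ih h1 h2 h3 h4 i hi h5)
  -- Without a return, `n + 1` nonzero orthogonal residuals would exist in dimension `n`.
  have := ((hall n).regular hH hε hζ hU hg).le_dim hH
  omega

/-- The number of products in terms of the number of passes of the loop. -/
lemma CappedCG.exists_passes {t : DType} {d : E n} {N : ℕ} (h : CappedCG H g ε ζ U₀ t d N) :
    N = 1 ∨ ∃ j, CGReaches H g ε ζ U₀ j ∧ N ≤ 1 + 4 * j := by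
  cases h with
  | initial h => exact Or.inl rfl
  | curvY j hj _ => exact Or.inr ⟨j, hj, by rw [cgState_hv]; omega⟩
  | solution j hj _ _ => exact Or.inr ⟨j, hj, by rw [cgState_hv]; omega⟩
  | curvP j hj _ _ _ => exact Or.inr ⟨j, hj, by rw [cgState_hv]; omega⟩
  | slow j hj _ _ _ _ i _ _ => exact Or.inr ⟨j, hj, by rw [cgState_hv]; omega⟩

lemma CappedCG.negCurv {d : E n} {N : ℕ} (h : CappedCG H g ε ζ U₀ DType.NC d N) :
    NegCurv H ε d := by
  cases h with
  | initial h => exact h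
  | curvY j _ h => exact h
  | curvP j _ _ _ h => exact h
  | slow j _ _ _ _ _ i _ h => exact h

/-- The properties of a direction of type SOL. -/
lemma CappedCG.sol (hH : ∀ u v, ⟪H u, v⟫_ℝ = ⟪u, H v⟫_ℝ) (hε : 0 < ε)
    (hζ : ζ ∈ Set.Ioo (0 : ℝ) 1) (hU : 0 ≤ U₀) (hg : g ≠ 0) {d : E n} {N : ℕ}
    (h : CappedCG H g ε ζ U₀ DType.SOL d N) :
    ε * ‖d‖ ^ 2 ≤ ⟪d, damped H ε d⟫_ℝ ∧ ⟪g, d⟫_ℝ = -⟪d, damped H ε d⟫_ℝ ∧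
      ‖g + damped H ε d‖ ≤ ζ / 2 * ε * ‖d‖ := by
  cases h with
  | solution j hj h1 h2 =>
    refine ⟨not_lt.1 h1, ?_, ?_⟩
    · have h3 := (hj.regular hH hε hζ.1 hU hg).inner_r_y hH le_rfl
      rw [cgState_r_eq, inner_add_left, damped_symm hH] at h3
      linarith
    · rw [← cgState_r_eq]
      have h3 := norm_damped_le hε (norm_H_y_le (H := H) (g := g) (ε := ε) (U₀ := U₀) j)
      have hk := two_le_kappa hε (hU.trans (le_cgState_U (H := H) (g := g) (ε := ε) j))
      have h4 : ‖g‖ ≤ ‖(cgState H g ε U₀ j).r‖ + ‖damped H ε (cgState H g ε U₀ j).y‖ := by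
        have : g = (cgState H g ε U₀ j).r - damped H ε (cgState H g ε U₀ j).y := by
          rw [cgState_r_eq, add_sub_cancel_right]
        conv_lhs => rw [this]
        exact norm_sub_le _ _
      rw [Accurate] at h2
      set U := (cgState H g ε U₀ j).U
      have hkε : U + 2 * ε = kappa ε U * ε := by
        rw [kappa]
        field_simp
      have hz : zetaHat ε ζ U * kappa ε U = ζ / 3 := by
        rw [zetaHat]
        field_simp
      have hz0 : 0 ≤ zetaHat ε ζ U := by
        have := hζ.1
        rw [zetaHat]
        positivity
      have hz1 : zetaHat ε ζ U ≤ 1 / 6 := by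
        have := hζ.2
        nlinarith
      have hr := norm_nonneg (cgState H g ε U₀ j).r
      have hy : 0 ≤ ε * ‖(cgState H g ε U₀ j).y‖ := by positivity
      rw [hkε] at h3
      -- With `ζ̂κ = ζ/3` and `ζ̂ ≤ 1/6`, `‖r‖ ≤ ζ̂(‖r‖ + κε‖y‖)` gives `(5/6)‖r‖ ≤ (ζ/3)ε‖y‖`,
      -- better than the factor `ζ/2` needed.
      have h5 := mul_le_mul_of_nonneg_left (h4.trans (add_le_add_right h3 _)) hz0
      have h6 : zetaHat ε ζ U * (‖(cgState H g ε U₀ j).r‖ +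
          kappa ε U * ε * ‖(cgState H g ε U₀ j).y‖) =
          zetaHat ε ζ U * ‖(cgState H g ε U₀ j).r‖ + ζ / 3 * (ε * ‖(cgState H g ε U₀ j).y‖) := by
        rw [← hz]
        ring
      nlinarith [mul_le_mul_of_nonneg_right hz1 hr, mul_nonneg hζ.1.le hy]

end CappedMethod

/-! ### The natural length scale and exponent-free Taylor bounds -/

section Scaling

/-- The reciprocal `(H_ν / ε)^{1/(1+ν)}` of the natural length scale. -/
noncomputable def invScale (ν Hν ε : ℝ) : ℝ := (Hν / ε) ^ (1 / (1 + ν))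

variable {ν Hν ε : ℝ}

lemma invScale_pos (hH : 0 < Hν) (hε : 0 < ε) : 0 < invScale ν Hν ε :=
  Real.rpow_pos_of_pos (div_pos hH hε) _

lemma invScale_rpow (hν : 0 ≤ ν) (hH : 0 < Hν) (hε : 0 < ε) :
    invScale ν Hν ε ^ (1 + ν) = Hν / ε := by
  rw [invScale, ← Real.rpow_mul (div_pos hH hε).le, one_div_mul_cancel (by linarith),
    Real.rpow_one]

lemma gammaNu_eq (hν : 0 ≤ ν) (hH : 0 < Hν) (hε : 0 < ε) :
    gammaNu ν Hν ε = 4 * ε * invScale ν Hν ε ^ 2 := by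
  have h1 : (1 + ν) ≠ 0 := by linarith
  have h2 : invScale ν Hν ε ^ 2 = Hν ^ (2 / (1 + ν)) * ε ^ (-(2 / (1 + ν))) := by
    rw [← Real.rpow_natCast, invScale, ← Real.rpow_mul (div_pos hH hε).le,
      Real.div_rpow hH.le hε.le, Real.rpow_neg hε.le, div_eq_mul_inv]
    have h3 : 1 / (1 + ν) * ((2 : ℕ) : ℝ) = 2 / (1 + ν) := by
      push_cast
      ring
    rw [h3]
  have h3 : ε ^ (-((1 - ν) / (1 + ν))) = ε * ε ^ (-(2 / (1 + ν))) := by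
    rw [mul_comm, ← Real.rpow_add_one hε.ne']
    congr 1
    field_simp
    ring
  rw [gammaNu, h2, h3]
  ring

lemma sqrt_gammaNu (hν : 0 ≤ ν) (hH : 0 < Hν) (hε : 0 < ε) :
    √(gammaNu ν Hν ε * ε) = 2 * ε * invScale ν Hν ε := by
  have := invScale_pos (ν := ν) hH hε
  rw [gammaNu_eq hν hH hε, Real.sqrt_eq_iff_mul_self_eq_of_pos (by positivity)]
  ring

lemma sqrt_gammaNu_mul (hν : 0 ≤ ν) (hH : 0 < Hν) (hε : 0 < ε) :
    √(gammaNu ν Hν ε) * ε ^ (-(3 / 2) : ℝ) = 2 * (invScale ν Hν ε / ε) := by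
  have h0 := invScale_pos (ν := ν) hH hε
  have h1 : √(gammaNu ν Hν ε) = 2 * √ε * invScale ν Hν ε := by
    rw [gammaNu_eq hν hH hε, Real.sqrt_eq_iff_mul_self_eq_of_pos (by positivity)]
    linear_combination 4 * invScale ν Hν ε ^ 2 * Real.mul_self_sqrt hε.le
  have h2 : √ε * ε ^ (-(3 / 2) : ℝ) = ε⁻¹ := by
    rw [Real.sqrt_eq_rpow, ← Real.rpow_add hε, ← Real.rpow_neg_one]
    norm_num
  rw [h1, div_eq_mul_inv _ ε]
  generalize ε ^ (-(3 / 2) : ℝ) = w at h2 ⊢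
  linear_combination 2 * invScale ν Hν ε * h2

lemma iterOrder_eq (hν : 0 ≤ ν) (hH : 0 < Hν) (hε : 0 < ε) :
    iterOrder ν Hν ε = invScale ν Hν ε / ε := by
  have h1 : (1 + ν) ≠ 0 := by linarith
  rw [iterOrder, invScale, Real.div_rpow hH.le hε.le, div_div, div_eq_mul_inv]
  congr 1
  rw [← Real.rpow_add_one hε.ne', ← Real.rpow_neg hε.le]
  congr 1
  field_simp
  ring

lemma cgOrder_eq (hν : 0 ≤ ν) (hH : 0 < Hν) (hε : 0 < ε) (UH : ℝ) :
    cgOrder ν Hν UH ε = √UH / √(ε * invScale ν Hν ε) := by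
  have h1 : (1 + ν) ≠ 0 := by linarith
  have h2 : ε * invScale ν Hν ε = (Hν * ε ^ ν) ^ (1 / (1 + ν)) := by
    have h3 : Hν * ε ^ ν = ε ^ (1 + ν) * (Hν / ε) := by
      rw [Real.rpow_add hε, Real.rpow_one]
      field_simp
    rw [h3, Real.mul_rpow (by positivity) (by positivity), ← Real.rpow_mul hε.le,
      mul_one_div_cancel h1, Real.rpow_one, invScale]
  rw [cgOrder, h2, Real.sqrt_eq_rpow ((Hν * ε ^ ν) ^ (1 / (1 + ν))),
    ← Real.rpow_mul (by positivity)]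
  congr 2
  field_simp

lemma taylor_bound_eq (hν : 0 ≤ ν) (hH : 0 < Hν) (hε : 0 < ε) {t : ℝ} (ht : 0 ≤ t) :
    Hν / (1 + ν) * t ^ (1 + ν) = ε * ((invScale ν Hν ε * t) ^ (1 + ν) / (1 + ν)) := by
  rw [Real.mul_rpow (invScale_pos hH hε).le ht, invScale_rpow hν hH hε]
  field_simp

/-- Bernoulli's inequality for the exponent `(1+ν)/2 ≤ 1` applied to `z² = 1 + (z² - 1)`. -/
lemma rpow_one_add_div_le (hν : ν ∈ Set.Icc (0 : ℝ) 1) {z : ℝ} (hz : 0 ≤ z) :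
    z ^ (1 + ν) / (1 + ν) ≤ (z ^ 2 + 1) / 2 := by
  have h1 : 0 < 1 + ν := by linarith [hν.1]
  have h2 := rpow_one_add_le_one_add_mul_self (s := z ^ 2 - 1) (p := (1 + ν) / 2)
    (by nlinarith) (by positivity) (by linarith [hν.2])
  rw [add_sub_cancel, ← Real.rpow_natCast, ← Real.rpow_mul hz] at h2
  have h3 : ((2 : ℕ) : ℝ) * ((1 + ν) / 2) = 1 + ν := by
    push_cast
    ring
  rw [h3, Real.rpow_natCast] at h2
  rw [div_le_iff₀ h1]
  nlinarith [hν.1, hν.2]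

lemma rpow_one_add_div_le_self (hν : 0 ≤ ν) {z : ℝ} (hz : 0 ≤ z) (hz1 : z ≤ 1) :
    z ^ (1 + ν) / (1 + ν) ≤ z := by
  have h1 : z ^ (1 + ν) ≤ z := by
    rcases hz.eq_or_lt with rfl | hz
    · rw [Real.zero_rpow (by linarith)]
    · simpa using Real.rpow_le_rpow_of_exponent_ge hz hz1 (by linarith : (1 : ℝ) ≤ 1 + ν)
  exact (div_le_self (Real.rpow_nonneg hz _) (by linarith)).trans h1

variable {n : ℕ} {f : E n → ℝ} {x₀ : E n} {Ω : Set (E n)}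

lemma HolderHessian.taylor_le (h : HolderHessian f x₀ ν Hν Ω) (hε : 0 < ε) {x v : E n}
    (hx : x ∈ Ω) (hy : x + v ∈ Ω) :
    ‖∇ f (x + v) - ∇ f x - hessian f x v‖ ≤ ε * (((invScale ν Hν ε * ‖v‖) ^ 2 + 1) / 2) := by
  have h1 := gradient_taylor h hx hy
  have hρ := invScale_pos (ν := ν) h.modulus_pos hε
  rw [add_sub_cancel_left, taylor_bound_eq h.exponent_mem.1 h.modulus_pos hε (norm_nonneg _)] at h1
  exact h1.trans (mul_le_mul_of_nonneg_left
    (rpow_one_add_div_le h.exponent_mem (by positivity)) hε.le)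

lemma HolderHessian.taylor_le_of_short (h : HolderHessian f x₀ ν Hν Ω) (hε : 0 < ε) {x v : E n}
    (hx : x ∈ Ω) (hy : x + v ∈ Ω) (hv : invScale ν Hν ε * ‖v‖ ≤ 1) :
    ‖∇ f (x + v) - ∇ f x - hessian f x v‖ ≤ ε * (invScale ν Hν ε * ‖v‖) := by
  have h1 := gradient_taylor h hx hy
  have hρ := invScale_pos (ν := ν) h.modulus_pos hε
  rw [add_sub_cancel_left, taylor_bound_eq h.exponent_mem.1 h.modulus_pos hε (norm_nonneg _)] at h1
  exact h1.trans (mul_le_mul_of_nonneg_left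
    (rpow_one_add_div_le_self h.exponent_mem.1 (by positivity) hv) hε.le)

/-- The slope at a short step in terms of the data at the base point. -/
lemma HolderHessian.slope_le (h : HolderHessian f x₀ ν Hν Ω) (hε : 0 < ε) {x d : E n} {t : ℝ}
    (ht : 0 ≤ t) (hx : x ∈ Ω) (hy : x + t • d ∈ Ω)
    (hv : invScale ν Hν ε * (t * ‖d‖) ≤ 1) :
    ⟪∇ f (x + t • d), d⟫_ℝ ≤ ⟪∇ f x, d⟫_ℝ + t * ⟪d, hessian f x d⟫_ℝ +
      t * (ε * invScale ν Hν ε * ‖d‖ ^ 2) := by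
  have hn : ‖t • d‖ = t * ‖d‖ := by rw [norm_smul, Real.norm_of_nonneg ht]
  have h1 := h.taylor_le_of_short hε hx hy (by rw [hn]; exact hv)
  have h2 := (real_inner_le_norm (∇ f (x + t • d) - ∇ f x - hessian f x (t • d)) d).trans
    (mul_le_mul_of_nonneg_right h1 (norm_nonneg d))
  rw [inner_sub_left, inner_sub_left, map_smul, real_inner_smul_left, hn,
    real_inner_comm d (hessian f x d)] at h2
  linarith

end Scaling

/-! ### Backtracking -/

section LineSearch

variable {n : ℕ} {f : E n → ℝ} {x d : E n} {c θ : ℝ} {S : Set ℕ}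

lemma exists_isLeast_search (hθ : θ ∈ Set.Ioo (0 : ℝ) 1)
    (hS : ∀ i, i ∈ S ↔ f (x + θ ^ i • d) ≤ f x - c * (θ ^ i) ^ 2)
    (h : ∀ᶠ t in 𝓝[>] (0 : ℝ), f (x + t • d) < f x - c * t ^ 2) : ∃ j, IsLeast S j := by
  have ht : Tendsto (fun i : ℕ => θ ^ i) atTop (𝓝[>] (0 : ℝ)) :=
    tendsto_nhdsWithin_iff.2 ⟨tendsto_pow_atTop_nhds_zero_of_lt_one hθ.1.le hθ.2,
      Eventually.of_forall fun i => pow_pos hθ.1 i⟩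
  obtain ⟨i, hi⟩ := (ht.eventually h).exists
  exact ⟨_, isLeast_csInf (s := S) ⟨i, (hS i).2 hi.le⟩⟩

/-- Minimality of `j` is used only through failure of the preceding trial step. -/
lemma search_cases (hS : ∀ i, i ∈ S ↔ f (x + θ ^ i • d) ≤ f x - c * (θ ^ i) ^ 2) {j : ℕ}
    (hj : IsLeast S j) : j = 0 ∨ ∃ i, j = i + 1 ∧ f x - c * (θ ^ i) ^ 2 < f (x + θ ^ i • d) := by
  cases j with
  | zero => exact Or.inl rfl
  | succ i =>
    refine Or.inr ⟨i, rfl, ?_⟩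
    by_contra hcon
    have := hj.2 ((hS i).2 (not_lt.1 hcon))
    omega

end LineSearch

/-! ### Decrease along SOL directions; the rescaled NC direction -/

section Decrease

variable {n : ℕ} {f : E n → ℝ} {x₀ : E n} {ν Hν ε ζ θ η : ℝ} {Ω : Set (E n)}

lemma inner_damped (H : E n →L[ℝ] E n) (a : ℝ) (d : E n) :
    ⟪d, damped H a d⟫_ℝ = ⟪d, H d⟫_ℝ + 2 * a * ‖d‖ ^ 2 := by
  simp [damped, inner_add_right, inner_smul_right]

/-- A direction with the properties of those of type SOL. -/
structure IsSolDirection (f : E n → ℝ) (x : E n) (a ζ : ℝ) (d : E n) : Prop where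
  ne_zero : d ≠ 0
  curv : a * ‖d‖ ^ 2 ≤ ⟪d, damped (hessian f x) a d⟫_ℝ
  slope : ⟪∇ f x, d⟫_ℝ = -⟪d, damped (hessian f x) a d⟫_ℝ
  residual : ‖∇ f x + damped (hessian f x) a d‖ ≤ ζ / 2 * a * ‖d‖

lemma IsSolDirection.slope_neg {x d : E n} {a : ℝ} (ha : 0 < a)
    (hd : IsSolDirection f x a ζ d) : ⟪∇ f x, d⟫_ℝ < 0 := by
  have h1 := norm_pos_iff.2 hd.ne_zero
  have h2 : 0 < a * ‖d‖ ^ 2 := by positivity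
  linarith [hd.curv, hd.slope]

/-- A full step to a point with a large gradient is long. -/
lemma IsSolDirection.full_step_long (h : HolderHessian f x₀ ν Hν Ω) (hε : 0 < ε) {x d : E n}
    (hx : x ∈ Ω) (hd : IsSolDirection f x (2 * ε * invScale ν Hν ε) ζ d) (hy : x + d ∈ Ω)
    (hg : ε < ‖∇ f (x + d)‖) :
    1 < (invScale ν Hν ε * ‖d‖) ^ 2 + 2 * (4 + ζ) * (invScale ν Hν ε * ‖d‖) := by
  set ρ := invScale ν Hν ε
  have hρ : 0 < ρ := invScale_pos h.modulus_pos hε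
  have h1 := h.taylor_le hε hx hy
  have h2 : ∇ f (x + d) = (∇ f (x + d) - ∇ f x - hessian f x d) +
      (∇ f x + damped (hessian f x) (2 * ε * ρ) d) - (2 * (2 * ε * ρ)) • d := by
    simp only [damped, add_apply, smul_apply, ContinuousLinearMap.id_apply]
    abel
  have h3 : ‖∇ f (x + d)‖ ≤ ‖∇ f (x + d) - ∇ f x - hessian f x d‖ +
      ‖∇ f x + damped (hessian f x) (2 * ε * ρ) d‖ + ‖(2 * (2 * ε * ρ)) • d‖ := by
    conv_lhs => rw [h2]
    exact (norm_sub_le _ _).trans (add_le_add_left (norm_add_le _ _) _)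
  rw [norm_smul, Real.norm_of_nonneg (by positivity)] at h3
  have h4 := hd.residual
  have h5 : ε * 1 < ε * (((ρ * ‖d‖) ^ 2 + 1) / 2 + ζ * (ρ * ‖d‖) + 4 * (ρ * ‖d‖)) := by
    linarith
  linarith [lt_of_mul_lt_mul_left h5 hε.le]

/-- A critical short step along a direction of type SOL is a large fraction of the full step. -/
lemma IsSolDirection.critical_step (h : HolderHessian f x₀ ν Hν Ω) (hε : 0 < ε) {x d : E n}
    (hx : x ∈ Ω) (hd : IsSolDirection f x (2 * ε * invScale ν Hν ε) ζ d) {t c : ℝ}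
    (ht : t ∈ Set.Ioo (0 : ℝ) 1) (hy : x + t • d ∈ Ω)
    (hcrit : ⟪∇ f (x + t • d), d⟫_ℝ =
      -(2 * (c * (2 * ε * invScale ν Hν ε) * ‖d‖ ^ 2) * t))
    (hshort : invScale ν Hν ε * (t * ‖d‖) ≤ 1) : 2 + t ≤ 4 * c * t := by
  set ρ := invScale ν Hν ε
  have hρ : 0 < ρ := invScale_pos h.modulus_pos hε
  have h1 := h.slope_le hε ht.1.le hx hy hshort
  have h2 := hd.curv
  have h3 := hd.slope
  rw [inner_damped] at h2 h3
  have hd0 := norm_pos_iff.2 hd.ne_zero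
  have hp : 0 < ε * ρ * ‖d‖ ^ 2 := by positivity
  -- With `Q = ⟪d, H̄ d⟫ ≥ 2ερ‖d‖²`, the slope at `t` is at most `-(1-t)Q - 3tερ‖d‖²`, hence at most
  -- `-(2+t)ερ‖d‖²`.
  have h4 := mul_le_mul_of_nonneg_left h2 (sub_nonneg.2 ht.2.le)
  rw [hcrit, h3] at h1
  refine le_of_mul_le_mul_right ?_ hp
  linarith

lemma IsSolDirection.decrease (h : HolderHessian f x₀ ν Hν Ω) (hε : 0 < ε)
    (hζ : ζ ∈ Set.Ioo (0 : ℝ) 1) (hθ : θ ∈ Set.Ioo (0 : ℝ) 1) (hη : η ∈ Set.Ioo (0 : ℝ) 1)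
    {x d : E n} (hx : x ∈ levelSet f x₀)
    (hd : IsSolDirection f x (2 * ε * invScale ν Hν ε) ζ d)
    (hs : ¬ (f (x + d) ≤ f x ∧ ‖∇ f (x + d)‖ ≤ ε)) {j : ℕ}
    (hj : IsLeast {i : ℕ | f (x + θ ^ i • d) ≤
        f x - η * (2 * ε * invScale ν Hν ε) * θ ^ (2 * i) * ‖d‖ ^ 2} j) :
    cSol ζ θ η * (ε / (2 * invScale ν Hν ε)) ≤ f x - f (x + θ ^ j • d) := by
  set ρ := invScale ν Hν ε with hρdef
  have hρ : 0 < ρ := invScale_pos h.modulus_pos hε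
  have hxΩ := h.subset hx
  have hd0 := norm_pos_iff.2 hd.ne_zero
  have hlev : ∀ {y : E n}, f y ≤ f x → y ∈ Ω := fun hy => h.subset (hy.trans hx)
  set c := η * (2 * ε * ρ) * ‖d‖ ^ 2 with hc
  have hη0 := hη.1
  have hθ0 := hθ.1
  have hS : ∀ i, i ∈ {i : ℕ | f (x + θ ^ i • d) ≤
      f x - η * (2 * ε * ρ) * θ ^ (2 * i) * ‖d‖ ^ 2} ↔
      f (x + θ ^ i • d) ≤ f x - c * (θ ^ i) ^ 2 := by
    intro i
    rw [Set.mem_ofPred_eq, hc, pow_mul', mul_right_comm]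
  have hsmall : ∀ c', ∀ᶠ t in 𝓝[>] (0 : ℝ), f (x + t • d) < f x - c' * t ^ 2 := fun c' =>
    eventually_decrease_of_descent h.contDiff c' (hd.slope_neg (by positivity))
  have hdec := (hS j).1 hj.1
  -- It suffices to bound the accepted step length below by `z/ρ`: a step of scaled length `z` gains
  -- `4ηz² · ε/(2ρ)`.
  have hcs : ∀ z, cSol ζ θ η ≤ 4 * η * z ^ 2 → z ≤ ρ * (θ ^ j * ‖d‖) → 0 ≤ z →
      cSol ζ θ η * (ε / (2 * ρ)) ≤ f x - f (x + θ ^ j • d) := by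
    intro z hz hzle hz0
    have h1 : z ^ 2 ≤ (ρ * (θ ^ j * ‖d‖)) ^ 2 := pow_le_pow_left₀ hz0 hzle 2
    have h2 : cSol ζ θ η * (ε / (2 * ρ)) ≤
        4 * η * (ρ * (θ ^ j * ‖d‖)) ^ 2 * (ε / (2 * ρ)) := by
      gcongr
      nlinarith
    have h3 : 4 * η * (ρ * (θ ^ j * ‖d‖)) ^ 2 * (ε / (2 * ρ)) = c * (θ ^ j) ^ 2 := by
      rw [hc]
      field_simp
      ring
    linarith
  have hlong : f (x + d) ≤ f x →
      1 < (ρ * ‖d‖) ^ 2 + 2 * (4 + ζ) * (ρ * ‖d‖) := fun hle =>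
    hd.full_step_long h hε hxΩ (hlev hle) (not_le.1 fun hg => hs ⟨hle, hg⟩)
  rcases search_cases hS hj with rfl | ⟨i, rfl, hfail⟩
  · rw [pow_zero, one_smul] at hdec
    have h1 := hlong (hdec.trans (by rw [hc]; simp; positivity))
    have hsq := Real.sq_sqrt (by positivity : 0 ≤ (4 + ζ) ^ 2 + 1)
    have hA : 0 < 4 + ζ := by linarith [hζ.1]
    -- The witness is the positive root of `z² + 2(4+ζ)z = 1`, the threshold of `full_step_long`.
    refine hcs (1 / (4 + ζ + √((4 + ζ) ^ 2 + 1))) ?_ ?_ (by positivity)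
    · rw [cSol]
      have : 4 * η * (1 / (4 + ζ + √((4 + ζ) ^ 2 + 1))) ^ 2 =
        η * (2 / (4 + ζ + √((4 + ζ) ^ 2 + 1))) ^ 2 := by ring
      rw [this]
      exact mul_le_mul_of_nonneg_left (min_le_left _ _) hη0.le
    · rw [pow_zero, one_mul, div_le_iff₀ (by positivity)]
      by_contra hcon
      have hs0 := Real.sqrt_nonneg ((4 + ζ) ^ 2 + 1)
      have hlt : √((4 + ζ) ^ 2 + 1) < ρ * ‖d‖ + (4 + ζ) :=
        (Real.sqrt_lt' (by positivity)).2 (by nlinarith)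
      nlinarith
  · have hθi : 0 < θ ^ i := pow_pos hθ0 i
    have hθi1 : θ ^ i ≤ 1 := pow_le_one₀ hθ0.le hθ.2.le
    obtain ⟨t, ht, htle, hcrit⟩ := exists_critical_step h.contDiff (c := c) (by positivity) hθi
      (hsmall c) hfail
    have ht1 : t ∈ Set.Ioo (0 : ℝ) 1 := ⟨ht.1, ht.2.trans_le hθi1⟩
    have hcs' : cSol ζ θ η ≤ 2 * η / 27 * ((1 - η) * θ) ^ 2 := by
      rw [cSol]
      calc _ ≤ η * (1 / 6 * (2 * (1 - η) * θ / 3) ^ 2) :=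
            mul_le_mul_of_nonneg_left (min_le_right _ _) hη0.le
        _ = _ := by ring
    have hη1 : 0 < 1 - η := sub_pos.2 hη.2
    by_cases hshort : ρ * (t * ‖d‖) ≤ 1
    · have h2 := hd.critical_step h hε hxΩ ht1 (hlev htle) hcrit hshort
      -- From `2 + t ≤ 4ηt`: `η < 1` gives `t ≥ 2/3`, and `t < 1` gives `η ≥ 3/4`.
      have ht23 : 2 / 3 ≤ t := by nlinarith [ht1.1, hη.2]
      have hη34 : 3 / 4 ≤ η := by nlinarith [ht1.1, ht1.2]
      -- If the full step does not increase `f`, then `1 < z² + 10z`, which fails for `z ≤ 1/11`. If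
      -- it does, a critical step with `c = 0` would give `2 + s ≤ 0` when `z ≤ 1/11`.
      have hz : 1 / 11 < ρ * ‖d‖ := by
        have hz0 : 0 < ρ * ‖d‖ := by positivity
        by_cases hle : f (x + d) ≤ f x
        · have h3 := hlong hle
          by_contra hcon
          nlinarith [hζ.1, hζ.2]
        · obtain ⟨s, hs', hsle, hscrit⟩ := exists_critical_step h.contDiff (c := 0) le_rfl one_pos
            (hsmall 0) (by simpa using hle)
          by_contra hcon
          have := hd.critical_step h hε hxΩ (c := 0) hs' (hlev hsle) (by simpa using hscrit)
            (by nlinarith [hs'.1, hs'.2])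
          linarith [hs'.1]
      refine hcs (2 / 33 * θ) ?_ ?_ (by positivity)
      · refine hcs'.trans ?_
        have h4 : (1 - η) ^ 2 ≤ (1 / 4) ^ 2 := pow_le_pow_left₀ hη1.le (by linarith) 2
        have h5 : 0 ≤ η * θ ^ 2 := by positivity
        nlinarith [mul_le_mul_of_nonneg_left h4 h5]
      · rw [pow_succ]
        have h5 : 2 / 3 * (1 / 11) ≤ θ ^ i * (ρ * ‖d‖) :=
          mul_le_mul (ht23.trans ht.2.le) hz.le (by norm_num) hθi.le
        nlinarith
    · refine hcs θ ?_ ?_ hθ0.le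
      · refine hcs'.trans ?_
        have h4 : (1 - η) ^ 2 ≤ 1 := by nlinarith
        have h5 : 0 ≤ η * θ ^ 2 := by positivity
        nlinarith [mul_le_mul_of_nonneg_left h4 h5]
      · rw [pow_succ]
        have h5 : ρ * (t * ‖d‖) ≤ ρ * (θ ^ i * ‖d‖) := by gcongr; exact ht.2.le
        nlinarith [not_le.1 hshort]

/-- The properties of the rescaled direction of negative curvature. -/
lemma ncDirection_props {x v : E n} {γ a : ℝ} (hγ : 0 < γ) (ha : 0 < a)
    (hv : NegCurv (hessian f x) a v) :
    ∃ q, a ≤ q ∧ min 1 γ * ‖ncDirection f γ x v‖ = q ∧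
      ⟪∇ f x, ncDirection f γ x v⟫_ℝ ≤ 0 ∧
      ⟪ncDirection f γ x v, hessian f x (ncDirection f γ x v)⟫_ℝ =
        -q * ‖ncDirection f γ x v‖ ^ 2 := by
  rw [NegCurv, inner_damped] at hv
  have hv0 : 0 < ‖v‖ := by
    refine norm_pos_iff.2 ?_
    rintro rfl
    simp at hv
  have hneg : ⟪v, hessian f x v⟫_ℝ < 0 := by
    have : 0 < a * ‖v‖ ^ 2 := by positivity
    linarith
  have hm : min 1 γ * max 1 (1 / γ) = 1 := by
    rcases le_total 1 γ with h | h
    · rw [min_eq_left h, max_eq_left ((div_le_one hγ).2 h), one_mul]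
    · rw [min_eq_right h, max_eq_right ((le_div_iff₀ hγ).2 (by linarith)),
        mul_one_div_cancel hγ.ne']
  have hM : 0 < max 1 (1 / γ) := lt_max_of_lt_left one_pos
  have hsgn : |sgn ⟪v, ∇ f x⟫_ℝ| = 1 := by
    unfold sgn
    split_ifs <;> simp
  have hsgn' : 0 ≤ sgn ⟪v, ∇ f x⟫_ℝ * ⟪v, ∇ f x⟫_ℝ := by
    unfold sgn
    split_ifs with h
    · simpa using h
    · linarith
  set k := max 1 (1 / γ) * (|⟪v, hessian f x v⟫_ℝ| / ‖v‖ ^ 3) with hk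
  have hk0 : 0 ≤ k := by positivity
  have hdir : ncDirection f γ x v = (-(sgn ⟪v, ∇ f x⟫_ℝ) * k) • v := by
    rw [ncDirection, hk, mul_assoc]
  have hnorm : ‖ncDirection f γ x v‖ = k * ‖v‖ := by
    rw [hdir, norm_smul, Real.norm_eq_abs, abs_mul, abs_neg, hsgn, one_mul, abs_of_nonneg hk0]
  -- The scale factors cancel, so `q` is minus the Rayleigh quotient of `v`.
  have hq : min 1 γ * (k * ‖v‖) = -⟪v, hessian f x v⟫_ℝ / ‖v‖ ^ 2 := by
    rw [hk, abs_of_neg hneg, ← mul_assoc, ← mul_assoc, hm, one_mul]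
    field_simp
  refine ⟨-⟪v, hessian f x v⟫_ℝ / ‖v‖ ^ 2, ?_, ?_, ?_, ?_⟩
  · rw [le_div_iff₀ (by positivity)]
    linarith
  · rw [hnorm, hq]
  · rw [hdir, inner_smul_right, real_inner_comm v (∇ f x)]
    nlinarith [mul_nonneg hk0 hsgn']
  · rw [hnorm, hdir, map_smul, real_inner_smul_left, inner_smul_right]
    have h1 : (sgn ⟪v, ∇ f x⟫_ℝ) ^ 2 = 1 := by rw [← sq_abs, hsgn, one_pow]
    field_simp
    linear_combination k ^ 2 * ⟪v, hessian f x v⟫_ℝ * h1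

end Decrease

/-! ### Existence, decrease and cost of one iteration -/

section Step

variable {n : ℕ} {f : E n → ℝ} {x₀ : E n} {ν Hν ε ζ θ η : ℝ} {Ω : Set (E n)}

/-- Sufficient decrease holds for short steps along a rescaled direction of negative curvature. -/
lemma eventually_decrease_ncDirection (hf : ContDiff ℝ 2 f) (hη : η ∈ Set.Ioo (0 : ℝ) 1)
    {x d : E n} {q : ℝ} (hq : 0 < q) (hd : d ≠ 0) (hslope : ⟪∇ f x, d⟫_ℝ ≤ 0)
    (hcurv : ⟪d, hessian f x d⟫_ℝ = -q * ‖d‖ ^ 2) :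
    ∀ᶠ t in 𝓝[>] (0 : ℝ), f (x + t • d) < f x - η * q * ‖d‖ ^ 2 / 4 * t ^ 2 := by
  refine eventually_decrease_of_negCurv hf hslope ?_
  have := norm_pos_iff.2 hd
  have h1 : 0 < q * ‖d‖ ^ 2 := by positivity
  rw [hcurv]
  nlinarith [hη.2]

/-- A full step has `ρ‖d‖ ≥ 1/2` by the bounds on `q`. After backtracking, a critical step with
`ρt‖d‖ ≤ 1` would give `q ≤ ερ + ηq/2 < q`. -/
lemma nc_decrease (h : HolderHessian f x₀ ν Hν Ω) (hε : 0 < ε)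
    (hθ : θ ∈ Set.Ioo (0 : ℝ) 1) (hη : η ∈ Set.Ioo (0 : ℝ) 1) {x d : E n}
    (hx : x ∈ levelSet f x₀) {q : ℝ} (hq : 2 * ε * invScale ν Hν ε ≤ q)
    (hlong : q ≤ 4 * ε * invScale ν Hν ε ^ 2 * ‖d‖)
    (hslope : ⟪∇ f x, d⟫_ℝ ≤ 0) (hcurv : ⟪d, hessian f x d⟫_ℝ = -q * ‖d‖ ^ 2)
    {S : Set ℕ} (hS : ∀ i, i ∈ S ↔
      f (x + θ ^ i • d) ≤ f x - η * q * ‖d‖ ^ 2 / 4 * (θ ^ i) ^ 2) {j : ℕ} (hj : IsLeast S j) :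
    cNc θ η * (ε / (2 * invScale ν Hν ε)) ≤ f x - f (x + θ ^ j • d) := by
  set ρ := invScale ν Hν ε with hρdef
  have hρ : 0 < ρ := invScale_pos h.modulus_pos hε
  have hη0 := hη.1
  have hθ0 := hθ.1
  have hq0 : 0 < q := lt_of_lt_of_le (by positivity) hq
  have hd0 : 0 < ‖d‖ := by
    by_contra hcon
    have : 4 * ε * ρ ^ 2 * ‖d‖ ≤ 0 :=
      mul_nonpos_of_nonneg_of_nonpos (by positivity) (not_lt.1 hcon)
    linarith
  have hdec := (hS j).1 hj.1
  have hcs : ∀ z, θ ≤ 2 * z → z ≤ ρ * (θ ^ j * ‖d‖) →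
      cNc θ η * (ε / (2 * ρ)) ≤ f x - f (x + θ ^ j • d) := by
    intro z hz hzle
    have h1 : θ ^ 2 ≤ (2 * (ρ * (θ ^ j * ‖d‖))) ^ 2 :=
      pow_le_pow_left₀ hθ0.le (hz.trans (by linarith)) 2
    have h2 : cNc θ η * (ε / (2 * ρ)) ≤
        η * (2 * (ρ * (θ ^ j * ‖d‖))) ^ 2 / 4 * (ε / (2 * ρ)) := by
      rw [cNc]
      gcongr
    have h3 : η * (2 * (ρ * (θ ^ j * ‖d‖))) ^ 2 / 4 * (ε / (2 * ρ)) =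
        η * (2 * ε * ρ) * ‖d‖ ^ 2 / 4 * (θ ^ j) ^ 2 := by
      field_simp
    have h4 : η * (2 * ε * ρ) * ‖d‖ ^ 2 / 4 * (θ ^ j) ^ 2 ≤
        η * q * ‖d‖ ^ 2 / 4 * (θ ^ j) ^ 2 := by gcongr
    linarith
  rcases search_cases hS hj with rfl | ⟨i, rfl, hfail⟩
  · refine hcs (1 / 2) (by linarith [hθ.2]) ?_
    rw [pow_zero, one_mul]
    have h1 : 2 * ε * ρ * 1 ≤ 2 * ε * ρ * (2 * (ρ * ‖d‖)) := by
      refine (mul_one (2 * ε * ρ)).le.trans ((hq.trans hlong).trans (le_of_eq (by ring)))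
    linarith [le_of_mul_le_mul_left h1 (by positivity)]
  · have hθi : 0 < θ ^ i := pow_pos hθ0 i
    obtain ⟨t, ht, htle, hcrit⟩ := exists_critical_step h.contDiff
      (c := η * q * ‖d‖ ^ 2 / 4) (by positivity) hθi
      (eventually_decrease_ncDirection h.contDiff hη hq0 (norm_pos_iff.1 hd0) hslope hcurv) hfail
    have h1 : 1 < ρ * (t * ‖d‖) := by
      by_contra hcon
      have h2 := h.slope_le hε ht.1.le (h.subset hx) (h.subset (htle.trans hx)) (not_lt.1 hcon)
      rw [hcrit, hcurv] at h2
      have h3 : 0 < t * ‖d‖ ^ 2 := mul_pos ht.1 (by positivity)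
      have h4 : q * (t * ‖d‖ ^ 2) ≤ (ε * ρ + η * q / 2) * (t * ‖d‖ ^ 2) := by linarith
      have h5 := le_of_mul_le_mul_right h4 h3
      nlinarith [hη.2]
    refine hcs θ (by linarith) ?_
    rw [pow_succ]
    have h5 : ρ * (t * ‖d‖) ≤ ρ * (θ ^ i * ‖d‖) := by gcongr; exact ht.2.le
    nlinarith

lemma CappedCG.isSolDirection (hf : ContDiff ℝ 2 f) {a : ℝ} (ha : 0 < a)
    (hζ : ζ ∈ Set.Ioo (0 : ℝ) 1) {x d : E n} {N : ℕ} (hg : ∇ f x ≠ 0)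
    (h : CappedCG (hessian f x) (∇ f x) a ζ 0 DType.SOL d N) : IsSolDirection f x a ζ d := by
  obtain ⟨h1, h2, h3⟩ := h.sol (hessian_symm hf x) ha hζ le_rfl hg
  refine ⟨?_, h1, h2, h3⟩
  rintro rfl
  simp [hg] at h3

/-- Since `m‖d‖ = q`, the cubic decrease test is quadratic in the step length, in the form of the
critical-step lemma. -/
lemma nc_search_iff {x d : E n} {m q : ℝ} (hm : m * ‖d‖ = q) (i : ℕ) :
    i ∈ {i : ℕ | f (x + θ ^ i • d) ≤ f x - η * m * θ ^ (2 * i) * ‖d‖ ^ 3 / 4} ↔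
      f (x + θ ^ i • d) ≤ f x - η * q * ‖d‖ ^ 2 / 4 * (θ ^ i) ^ 2 := by
  have : η * m * θ ^ (2 * i) * ‖d‖ ^ 3 / 4 = η * q * ‖d‖ ^ 2 / 4 * (θ ^ i) ^ 2 := by
    rw [← hm, pow_mul']
    ring
  rw [Set.mem_ofPred_eq, this]

/-- The method never gets stuck at a point with a large gradient. -/
lemma exists_step (h : HolderHessian f x₀ ν Hν Ω) (hε : 0 < ε)
    (hζ : ζ ∈ Set.Ioo (0 : ℝ) 1) (hθ : θ ∈ Set.Ioo (0 : ℝ) 1) (hη : η ∈ Set.Ioo (0 : ℝ) 1)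
    {x : E n} (hg : ε < ‖∇ f x‖) :
    ∃ x' G N, NCGStep ⟨ε, ζ, θ, η, gammaNu ν Hν ε⟩ f x x' G N := by
  have hg0 : ∇ f x ≠ 0 := norm_pos_iff.1 (hε.trans hg)
  have hρ := invScale_pos (ν := ν) h.modulus_pos hε
  have hγ : 0 < gammaNu ν Hν ε := by
    rw [gammaNu_eq h.exponent_mem.1 h.modulus_pos hε]
    positivity
  have ha : 0 < √(gammaNu ν Hν ε * ε) := Real.sqrt_pos.2 (by positivity)
  obtain ⟨t, d, N, hd⟩ := exists_cappedCG (hessian_symm h.contDiff x) ha hζ.1 le_rfl hg0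
  cases t with
  | SOL =>
    by_cases hs : f (x + d) ≤ f x ∧ ‖∇ f (x + d)‖ ≤ ε
    · exact ⟨_, _, _, NCGStep.solFull d N hg hd hs⟩
    · have hsol := hd.isSolDirection h.contDiff ha hζ hg0
      obtain ⟨j, hj⟩ := exists_isLeast_search (c := η * √(gammaNu ν Hν ε * ε) * ‖d‖ ^ 2)
        (S := {i : ℕ | f (x + θ ^ i • d) ≤
          f x - η * √(gammaNu ν Hν ε * ε) * θ ^ (2 * i) * ‖d‖ ^ 2}) hθ
        (fun i => by rw [Set.mem_ofPred_eq, pow_mul', mul_right_comm])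
        (eventually_decrease_of_descent h.contDiff _ (hsol.slope_neg ha))
      exact ⟨_, _, _, NCGStep.solSearch d N j hg hd hs hj⟩
  | NC =>
    obtain ⟨q, hq, hmq, hslope, hcurv⟩ := ncDirection_props hγ ha hd.negCurv
    have hq0 := ha.trans_le hq
    obtain ⟨j, hj⟩ := exists_isLeast_search hθ (nc_search_iff hmq)
      (eventually_decrease_ncDirection h.contDiff hη hq0
        (fun h0 => by rw [h0, norm_zero, mul_zero] at hmq; exact hq0.ne hmq) hslope hcurv)
    exact ⟨_, _, _, NCGStep.negCurv d N j hg hd hj⟩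

/-- An iteration decreases `f` by a fixed amount, unless it ends at a point with a small
gradient. -/
lemma NCGStep.decrease (h : HolderHessian f x₀ ν Hν Ω) (hε : 0 < ε)
    (hζ : ζ ∈ Set.Ioo (0 : ℝ) 1) (hθ : θ ∈ Set.Ioo (0 : ℝ) 1) (hη : η ∈ Set.Ioo (0 : ℝ) 1)
    {x x' : E n} (hx : x ∈ levelSet f x₀) {G N : ℕ}
    (hstep : NCGStep ⟨ε, ζ, θ, η, gammaNu ν Hν ε⟩ f x x' G N) :
    ε < ‖∇ f x‖ ∧ ((f x' ≤ f x ∧ ‖∇ f x'‖ ≤ ε) ∨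
      min (cSol ζ θ η) (cNc θ η) * (ε / (2 * invScale ν Hν ε)) ≤ f x - f x') := by
  have hρ := invScale_pos (ν := ν) h.modulus_pos hε
  have hγeq := gammaNu_eq h.exponent_mem.1 h.modulus_pos hε
  have hsq := sqrt_gammaNu h.exponent_mem.1 h.modulus_pos hε
  have ha : 0 < 2 * ε * invScale ν Hν ε := by positivity
  have hp : 0 ≤ ε / (2 * invScale ν Hν ε) := by positivity
  cases hstep with
  | solFull d N hg hd hs => exact ⟨hg, Or.inl hs⟩
  | solSearch d N j hg hd hs hj =>
    simp only [hsq] at hg hd hs hj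
    have hsol := hd.isSolDirection h.contDiff ha hζ (norm_pos_iff.1 (hε.trans hg))
    exact ⟨hg, Or.inr ((mul_le_mul_of_nonneg_right (min_le_left _ _) hp).trans
      (hsol.decrease h hε hζ hθ hη hx hs hj))⟩
  | negCurv d N j hg hd hj =>
    simp only [hsq] at hg hd hj
    have hγ : 0 < gammaNu ν Hν ε := by
      rw [hγeq]
      positivity
    obtain ⟨q, hq, hmq, hslope, hcurv⟩ := ncDirection_props hγ ha hd.negCurv
    refine ⟨hg, Or.inr ((mul_le_mul_of_nonneg_right (min_le_right _ _) hp).trans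
      (nc_decrease h hε hθ hη hx hq ?_ hslope hcurv (nc_search_iff hmq) hj))⟩
    rw [← hmq, ← hγeq]
    exact mul_le_mul_of_nonneg_right (min_le_right _ _) (norm_nonneg _)

/-- The cost of an iteration in terms of a bound on the number of passes of the CG loop. -/
lemma NCGStep.cost_le {P : NCGInput} {x x' : E n} {G N : ℕ} (hstep : NCGStep P f x x' G N)
    {J : ℝ} (hJ0 : 0 ≤ J)
    (hJ : P.εg < ‖∇ f x‖ →
      ∀ j, CGReaches (hessian f x) (∇ f x) (√(P.γ * P.εg)) P.ζ 0 j → (j : ℝ) ≤ J) :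
    (G : ℝ) + N ≤ 3 + 4 * J := by
  have key : ∀ {t d M}, P.εg < ‖∇ f x‖ →
      CappedCG (hessian f x) (∇ f x) (√(P.γ * P.εg)) P.ζ 0 t d M → (M : ℝ) ≤ 1 + 4 * J := by
    intro t d M hg hd
    rcases hd.exists_passes with rfl | ⟨j, hj, hM⟩
    · push_cast
      linarith
    · have h1 := hJ hg j hj
      have h2 : (M : ℝ) ≤ 1 + 4 * j := by exact_mod_cast hM
      linarith
  cases hstep with
  | solFull d N hg hd hs => push_cast; linarith [key hg hd]
  | solSearch d N j hg hd hs hj => push_cast; linarith [key hg hd]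
  | negCurv d N j hg hd hj => push_cast; linarith [key hg hd]

end Step

/-! ### Bounding the passes of the CG loop -/

section Passes

variable {n : ℕ} {H : E n →L[ℝ] E n} {g : E n} {ε ζ U₀ : ℝ}

/-- While the residual is neither accurate nor decays slowly, the loop index is bounded. -/
lemma index_le_of_not_accurate (hε : 0 < ε) (hζ : ζ ∈ Set.Ioo (0 : ℝ) 1) {U B : ℝ}
    (hU : 0 ≤ U) (hUB : U ≤ B) {s : CGState n} (hsU : s.U = U) {i : ℕ}
    (h1 : ¬ Accurate g ε ζ s) (h2 : ¬ SlowDecay g ε i s) :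
    (i : ℝ) ≤ 2 * (√(kappa ε B) + 1) *
      Real.log (12 * kappa ε B ^ 3 * (√(kappa ε B) + 1) / ζ) := by
  have hk2 := two_le_kappa hε hU
  have hkB := kappa_mono hε hUB
  set κ := kappa ε U with hκ
  have hs0 : 0 < √κ := Real.sqrt_pos.2 (by linarith)
  set τ := tau ε U with hτ
  have hτ0 : 0 < τ := by
    rw [hτ, tau, ← hκ]
    positivity
  have h1τ : 1 - τ = 1 / (√κ + 1) := by
    rw [hτ, tau, ← hκ]
    field_simp
    ring
  have hτ1 : τ < 1 := (tau_mem ε U).2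
  have hst : √τ < 1 := by rw [Real.sqrt_lt' one_pos]; simpa using hτ1
  have hsτ := Real.sq_sqrt hτ0.le
  have hT : √(bigT ε U) = 2 * κ ^ 2 / (1 - √τ) := by
    rw [bigT, ← hκ, ← hτ, Real.sqrt_eq_iff_mul_self_eq_of_pos]
    · rw [div_mul_div_comm]
      congr 1 <;> ring
    · have : 0 < 1 - √τ := by linarith
      positivity
  have hTle : √(bigT ε U) ≤ 4 * κ ^ 2 * (√κ + 1) := by
    -- `1 - τ = (1-√τ)(1+√τ) ≤ 2(1-√τ)`.
    have h3 : 1 / (√κ + 1) / 2 ≤ 1 - √τ := by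
      rw [← h1τ]
      nlinarith [sq_nonneg (1 - √τ)]
    rw [hT, div_le_iff₀ (by linarith)]
    calc 2 * κ ^ 2 = 4 * κ ^ 2 * (√κ + 1) * (1 / (√κ + 1) / 2) := by
          field_simp
          ring
      _ ≤ _ := by gcongr
  have hT0 : 0 < √(bigT ε U) := by
    have : 0 < 1 - √τ := by linarith
    rw [hT]
    positivity
  rw [Accurate, hsU, not_le] at h1
  rw [SlowDecay, hsU, gt_iff_lt, not_lt] at h2
  have h3 := lt_of_mul_lt_mul_right (h1.trans_le h2) (norm_nonneg g)
  have hz : zetaHat ε ζ U = ζ / (3 * κ) := rfl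
  rw [hz, ← hτ] at h3
  have hz0 : 0 < ζ / (3 * κ) := div_pos hζ.1 (by positivity)
  have h4 := Real.log_lt_log hz0 h3
  rw [Real.log_mul hT0.ne' (Real.rpow_pos_of_pos hτ0 _).ne', Real.log_rpow hτ0] at h4
  have h5 := Real.log_le_sub_one_of_pos hτ0
  have h6 : Real.log (√(bigT ε U)) - Real.log (ζ / (3 * κ)) ≤
      Real.log (12 * kappa ε B ^ 3 * (√(kappa ε B) + 1) / ζ) := by
    rw [← Real.log_div hT0.ne' hz0.ne']
    refine Real.log_le_log (by positivity) ?_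
    have hζ0 := hζ.1
    have hkB0 : 0 ≤ kappa ε B := by linarith
    calc √(bigT ε U) / (ζ / (3 * κ)) ≤ 4 * κ ^ 2 * (√κ + 1) / (ζ / (3 * κ)) := by gcongr
      _ = 12 * κ ^ 3 * (√κ + 1) / ζ := by
        field_simp
        ring
      _ ≤ _ := by gcongr
  have h7 : (i : ℝ) / 2 * (1 / (√κ + 1)) ≤
      Real.log (12 * kappa ε B ^ 3 * (√(kappa ε B) + 1) / ζ) := by
    have h8 : (i : ℝ) / 2 * Real.log τ ≤ (i : ℝ) / 2 * -(1 / (√κ + 1)) := by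
      rw [← h1τ]
      exact mul_le_mul_of_nonneg_left (by linarith) (by positivity)
    linarith
  set l := Real.log (12 * kappa ε B ^ 3 * (√(kappa ε B) + 1) / ζ)
  have hl : 0 ≤ l := le_trans (by positivity) h7
  have h9 : (i : ℝ) ≤ 2 * (√κ + 1) * l := by
    rw [mul_one_div, div_div, div_le_iff₀ (by positivity)] at h7
    linarith
  refine h9.trans ?_
  gcongr

/-- The estimate applies to index `j - 1`, whose tests failed; this accounts for the extra `1`. For
`j = 1` no loop test has failed yet. -/
lemma CGReaches.index_le (hε : 0 < ε) (hζ : ζ ∈ Set.Ioo (0 : ℝ) 1) (hU : 0 ≤ U₀) {B : ℝ}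
    (hUB : U₀ ≤ B) (hB : ‖H‖ ≤ B) {j : ℕ} (h : CGReaches H g ε ζ U₀ j) :
    (j : ℝ) ≤ 1 + 2 * (√(kappa ε B) + 1) *
      Real.log (12 * kappa ε B ^ 3 * (√(kappa ε B) + 1) / ζ) := by
  obtain ⟨h1, -, h2⟩ := h
  rcases h1.eq_or_lt with rfl | h1
  · have hk := two_le_kappa hε (hU.trans hUB)
    have hs := Real.sqrt_nonneg (kappa ε B)
    have h3 : 1 ≤ 12 * kappa ε B ^ 3 * (√(kappa ε B) + 1) / ζ := by
      rw [le_div_iff₀ hζ.1]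
      have h4 : 1 ≤ kappa ε B ^ 3 := one_le_pow₀ (by linarith)
      have h5 := hζ.2
      nlinarith
    have := Real.log_nonneg h3
    rw [Nat.cast_one, le_add_iff_nonneg_right]
    positivity
  · obtain ⟨i, rfl⟩ : ∃ i, j = i + 1 := ⟨j - 1, by omega⟩
    obtain ⟨-, h3, -, h4⟩ := h2 i (by omega) (by omega)
    have := index_le_of_not_accurate hε hζ (hU.trans (le_cgState_U i)) (cgState_U_le hUB hB i)
      rfl h3 h4
    push_cast
    linarith

/-- The bound on the loop index in terms of `Y ≥ √(2 B / ε)`. -/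
lemma index_bound_le (hζ : ζ ∈ Set.Ioo (0 : ℝ) 1) {κ Y : ℝ} (hY : 0 ≤ Y) (hκ0 : 0 < κ)
    (hκ : κ ≤ (2 + Y) ^ 2) :
    1 + 2 * (√κ + 1) * Real.log (12 * κ ^ 3 * (√κ + 1) / ζ) ≤
      (58 + 16 * Real.log (24 / ζ)) * (max 1 Y * Real.log (2 + Y)) := by
  have hζ0 := hζ.1
  have hs : √κ ≤ 2 + Y := (Real.sqrt_le_left (by linarith)).2 hκ
  set l := Real.log (2 + Y) with hl
  have hl2 : 1 / 2 ≤ l := by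
    have : Real.log 2 ≤ l := Real.log_le_log two_pos (by linarith)
    linarith [Real.log_two_gt_d9]
  have hζ24 : 0 ≤ Real.log (24 / ζ) := by
    refine Real.log_nonneg ?_
    rw [le_div_iff₀ hζ0]
    linarith [hζ.2]
  have h1 : Real.log (12 * κ ^ 3 * (√κ + 1) / ζ) ≤ Real.log (24 / ζ) + 7 * l := by
    rw [hl, ← Real.log_rpow (by linarith), ← Real.log_mul (by positivity) (by positivity)]
    refine Real.log_le_log (by positivity) ?_
    have h2 : κ ^ 3 ≤ ((2 + Y) ^ 2) ^ 3 := pow_le_pow_left₀ hκ0.le hκ 3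
    have h3 : √κ + 1 ≤ 2 * (2 + Y) := by linarith
    have h4 : (2 + Y) ^ (7 : ℝ) = (2 + Y) ^ 7 := by norm_cast
    calc 12 * κ ^ 3 * (√κ + 1) / ζ ≤ 12 * ((2 + Y) ^ 2) ^ 3 * (2 * (2 + Y)) / ζ := by gcongr
      _ = _ := by
        rw [h4]
        ring
  -- `l ≥ 1/2` absorbs the additive constant; then `58 = 8·7 + 2`, the `2` paying for the leading
  -- `1`.
  have h2 : Real.log (12 * κ ^ 3 * (√κ + 1) / ζ) ≤ (2 * Real.log (24 / ζ) + 7) * l := by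
    nlinarith
  have hM1 : 1 ≤ max 1 Y := le_max_left _ _
  have hMY : Y ≤ max 1 Y := le_max_right _ _
  have h3 : 2 * (√κ + 1) ≤ 8 * max 1 Y := by linarith
  have h4 : 2 * (√κ + 1) * Real.log (12 * κ ^ 3 * (√κ + 1) / ζ) ≤
      8 * max 1 Y * ((2 * Real.log (24 / ζ) + 7) * l) :=
    (mul_le_mul_of_nonneg_left h2 (by positivity)).trans
      (mul_le_mul_of_nonneg_right h3 (by positivity))
  have h5 : 1 / 2 ≤ max 1 Y * l := by nlinarith
  nlinarith

end Passes

/-! ### Accumulation along a run -/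

section Run

variable {n : ℕ} {f : E n → ℝ} {x₀ : E n} {ν Hν ε ζ θ η : ℝ} {Ω : Set (E n)}

lemma cSol_pos (hζ : 0 < ζ) (hθ : 0 < θ) (hη : η ∈ Set.Ioo (0 : ℝ) 1) : 0 < cSol ζ θ η := by
  have h1 := sub_pos.2 hη.2
  have h2 := hη.1
  rw [cSol]
  refine mul_pos h2 (lt_min ?_ ?_) <;> positivity

lemma cNc_pos (hθ : 0 < θ) (hη : 0 < η) : 0 < cNc θ η := by
  rw [cNc]
  positivity

lemma mem_levelSet_self (f : E n → ℝ) (x₀ : E n) : x₀ ∈ levelSet f x₀ := le_refl (f x₀)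

/-- Along a run the iterates stay in the level set and `f` decreases by a fixed amount `D` per
iteration, except possibly in the last one. -/
lemma NCGRun.decrease {P : NCGInput} {flow D : ℝ} (hlow : ∀ x ∈ levelSet f x₀, flow ≤ f x)
    (hε : 0 < P.εg) (hD : 0 ≤ D)
    (hstep : ∀ x ∈ levelSet f x₀, ∀ x' G N, NCGStep P f x x' G N → P.εg < ‖∇ f x‖ ∧
      ((f x' ≤ f x ∧ ‖∇ f x'‖ ≤ P.εg) ∨ D ≤ f x - f x'))
    {k G N : ℕ} {x : E n} (hrun : NCGRun P f x₀ k x G N) :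
    x ∈ levelSet f x₀ ∧ (k * D ≤ f x₀ - f x ∨
      (‖∇ f x‖ ≤ P.εg ∧ ∃ m : ℕ, k = m + 1 ∧ m * D < f x₀ - flow)) := by
  induction hrun with
  | start => exact ⟨mem_levelSet_self f x₀, Or.inl (by simp)⟩
  | @step k x x' G N G' N' hrun hs ih =>
    obtain ⟨hx, hdec⟩ := ih
    obtain ⟨hg, hs'⟩ := hstep x hx x' G' N' hs
    have hk : k * D ≤ f x₀ - f x := hdec.resolve_right fun h => absurd h.1 (not_le.2 hg)
    have hx' : x' ∈ levelSet f x₀ := by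
      have hx1 : f x ≤ f x₀ := hx
      change f x' ≤ f x₀
      rcases hs' with h | h
      · exact h.1.trans hx
      · linarith
    refine ⟨hx', ?_⟩
    rcases hs' with h | h
    · refine Or.inr ⟨h.2, k, rfl, ?_⟩
      -- Strict, because equality would make `x` a minimiser with zero gradient. Strictness lets the
      -- ceiling absorb the final step, which need not decrease `f` by `D`.
      have hlt : flow < f x := by
        refine (hlow x hx).lt_of_ne fun heq => ?_
        have := gradient_eq_zero_of_le hx fun y hy => heq ▸ hlow y hy
        rw [this, norm_zero] at hg
        linarith
      linarith
    · refine Or.inl ?_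
      push_cast
      linarith

/-- The cost of a run, given a bound on the cost of an iteration. -/
lemma NCGRun.cost_le {P : NCGInput} {B : ℝ}
    (hmem : ∀ k x G N, NCGRun P f x₀ k x G N → x ∈ levelSet f x₀)
    (hB : ∀ x ∈ levelSet f x₀, ∀ x' G N, NCGStep P f x x' G N → (G : ℝ) + N ≤ B)
    {k G N : ℕ} {x : E n} (hrun : NCGRun P f x₀ k x G N) : (G : ℝ) + N ≤ k * B := by
  induction hrun with
  | start => simp
  | step hrun hs ih =>
    have := hB _ (hmem _ _ _ _ hrun) _ _ _ hs
    push_cast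
    linarith

/-- A method that is never stuck and makes a bounded number of iterations produces an output. -/
lemma exists_output {P : NCGInput} {K : ℕ}
    (h : ∀ k x G N, NCGRun P f x₀ k x G N → k + 1 ≤ K ∧
      (‖∇ f x‖ ≤ P.εg ∨ ∃ x' G' N', NCGStep P f x x' G' N')) :
    ∃ k x G N, NCGOutput P f x₀ k x G N := by
  by_contra! hcon
  have hall : ∀ k, ∃ x G N, NCGRun P f x₀ k x G N := by
    intro k
    induction k with
    | zero => exact ⟨_, _, _, NCGRun.start⟩
    | succ k ih =>
      obtain ⟨x, G, N, hrun⟩ := ih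
      rcases (h k x G N hrun).2 with hg | ⟨x', G', N', hs⟩
      · exact absurd ⟨hg, G, rfl, hrun⟩ (hcon k x (G + 1) N)
      · exact ⟨_, _, _, NCGRun.step hrun hs⟩
  obtain ⟨x, G, N, hrun⟩ := hall K
  have := (h K x G N hrun).1
  omega

/-- The factor of `C` in the operation count is at least `1/2`. -/
lemma half_le_workOrder (hn : 0 < n) {Y : ℝ} (hY : 0 ≤ Y) :
    1 / 2 ≤ min (n : ℝ) (max 1 Y * Real.log (2 + Y)) := by
  have h1 : (1 : ℝ) ≤ n := by exact_mod_cast hn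
  have h2 : Real.log 2 ≤ Real.log (2 + Y) := Real.log_le_log two_pos (by linarith)
  have h3 := Real.log_two_gt_d9
  refine le_min (by linarith) ?_
  nlinarith [le_max_left 1 Y]

end Run

end NewtonCG

open NewtonCG in
theorem mainTheorem3 (ζ θ η Δ : ℝ) (hζ : ζ ∈ Set.Ioo (0 : ℝ) 1) (hθ : θ ∈ Set.Ioo (0 : ℝ) 1)
    (hη : η ∈ Set.Ioo (0 : ℝ) 1) :
    ∃ C : ℝ, 0 < C ∧
      ∀ (n : ℕ), 0 < n →
      ∀ (f : NewtonCG.E n → ℝ) (x₀ : NewtonCG.E n) (ν Hν : ℝ) (Ω : Set (NewtonCG.E n)),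
        NewtonCG.HolderHessian f x₀ ν Hν Ω →
      ∀ (flow UH : ℝ), (∀ x ∈ NewtonCG.levelSet f x₀, flow ≤ f x) → 0 < UH →
        (∀ x ∈ NewtonCG.levelSet f x₀, ‖NewtonCG.hessian f x‖ ≤ UH) → f x₀ - flow ≤ Δ →
      ∀ (εg : ℝ), εg ∈ Set.Ioo (0 : ℝ) 1 →
      ∀ (P : NewtonCG.NCGInput), P = ⟨εg, ζ, θ, η, NewtonCG.gammaNu ν Hν εg⟩ →
        -- the method never gets stuck, and it makes at most `K₁` iterations
        (∀ (k : ℕ) (x : NewtonCG.E n) (G N : ℕ), NewtonCG.NCGRun P f x₀ k x G N →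
          k + 1 ≤ NewtonCG.K1 P (f x₀ - flow) ∧
          (‖∇ f x‖ ≤ εg ∨ ∃ (x' : NewtonCG.E n) (G' N' : ℕ), NewtonCG.NCGStep P f x x' G' N')) ∧
        (∃ (k : ℕ) (x : NewtonCG.E n) (G N : ℕ), NewtonCG.NCGOutput P f x₀ k x G N) ∧
        -- the order of `K₁`
        (NewtonCG.K1 P (f x₀ - flow) : ℝ) ≤ C * max 1 (NewtonCG.iterOrder ν Hν εg) ∧
        -- the output, and the number of gradient evaluations and Hessian-vector products
        (∀ (k : ℕ) (x : NewtonCG.E n) (G N : ℕ), NewtonCG.NCGOutput P f x₀ k x G N →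
          k ≤ NewtonCG.K1 P (f x₀ - flow) ∧ ‖∇ f x‖ ≤ εg ∧
          (G : ℝ) + (N : ℝ) ≤
            C * max 1 (NewtonCG.iterOrder ν Hν εg) *
              min (n : ℝ) (max 1 (NewtonCG.cgOrder ν Hν UH εg) *
                Real.log (2 + NewtonCG.cgOrder ν Hν UH εg))) := by
  set c := min (cSol ζ θ η) (cNc θ η) with hc
  have hc0 : 0 < c := lt_min (cSol_pos hζ.1 hθ.1 hη) (cNc_pos hθ.1 hη.1)
  set C₁ := 58 + 16 * Real.log (24 / ζ) with hC₁
  have hC₁1 : 1 ≤ C₁ := by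
    have : 0 ≤ Real.log (24 / ζ) := by
      refine Real.log_nonneg ?_
      rw [le_div_iff₀ hζ.1]
      linarith [hζ.2]
    linarith
  -- The `2` pays for the ceiling and for the `+ 1` in `K1`.
  set C₂ := 2 * |Δ| / c + 2 with hC₂
  have hC₂0 : 2 ≤ C₂ := by
    have : 0 ≤ 2 * |Δ| / c := by positivity
    linarith
  -- An iteration costs at most `3 + 4J` with `J = C₁W`, and `3 ≤ 6W` because `W ≥ 1/2`.
  refine ⟨C₂ * (6 + 4 * C₁), by positivity, ?_⟩
  intro n hn f x₀ ν Hν Ω h flow UH hlow hUH hhess hgap εg hεg P hP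
  have hε := hεg.1
  have hν := h.exponent_mem.1
  have hρ := invScale_pos (ν := ν) h.modulus_pos hε
  set ρ := invScale ν Hν εg with hρdef
  set D := c * (εg / (2 * ρ)) with hD
  have hD0 : 0 < D := by positivity
  have hgap0 : 0 ≤ f x₀ - flow := sub_nonneg.2 (hlow x₀ (mem_levelSet_self f x₀))
  have hK : K1 P (f x₀ - flow) = ⌈(f x₀ - flow) / D⌉₊ + 1 := by
    have h1 := sqrt_gammaNu_mul hν h.modulus_pos hε
    rw [K1, hP]
    simp only
    rw [← hc, mul_assoc, h1, hD, ← hρdef]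
    congr 2
    field_simp
  have hstep : ∀ x ∈ levelSet f x₀, ∀ x' G N, NCGStep P f x x' G N → P.εg < ‖∇ f x‖ ∧
      ((f x' ≤ f x ∧ ‖∇ f x'‖ ≤ P.εg) ∨ D ≤ f x - f x') := by
    subst hP
    exact fun x hx x' G N hs => hs.decrease h hε hζ hθ hη hx
  have hPε : P.εg = εg := by rw [hP]
  have hrun : ∀ k x G N, NCGRun P f x₀ k x G N → x ∈ levelSet f x₀ ∧
      k + 1 ≤ K1 P (f x₀ - flow) := by
    intro k x G N hr
    obtain ⟨hx, hdec⟩ := hr.decrease hlow (hPε ▸ hε) hD0.le hstep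
    refine ⟨hx, ?_⟩
    rw [hK]
    refine Nat.succ_le_succ ?_
    rcases hdec with hdec | ⟨-, m, rfl, hm⟩
    · have h1 : (k : ℝ) ≤ (f x₀ - flow) / D := by
        rw [le_div_iff₀ hD0]
        linarith [hlow x hx]
      exact_mod_cast h1.trans (Nat.le_ceil _)
    · exact Nat.lt_ceil.2 ((lt_div_iff₀ hD0).2 hm)
  have hbound : ∀ k x G N, NCGRun P f x₀ k x G N → k + 1 ≤ K1 P (f x₀ - flow) ∧
      (‖∇ f x‖ ≤ εg ∨ ∃ x' G' N', NCGStep P f x x' G' N') := by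
    intro k x G N hr
    refine ⟨(hrun k x G N hr).2, ?_⟩
    by_cases hg : ‖∇ f x‖ ≤ εg
    · exact Or.inl hg
    · exact Or.inr (hP ▸ exists_step h hε hζ hθ hη (not_le.1 hg))
  have hKle : (K1 P (f x₀ - flow) : ℝ) ≤ C₂ * max 1 (iterOrder ν Hν εg) := by
    rw [hK, iterOrder_eq hν h.modulus_pos hε, ← hρdef]
    push_cast
    have h1 := (Nat.ceil_lt_add_one (a := (f x₀ - flow) / D) (by positivity)).le
    have h2 : (f x₀ - flow) / D ≤ 2 * |Δ| / c * (ρ / εg) := by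
      have h3 : 2 * |Δ| / c * (ρ / εg) = |Δ| / D := by
        rw [hD]
        field_simp
      rw [h3]
      gcongr
      exact hgap.trans (le_abs_self Δ)
    have h4 : 2 * |Δ| / c * (ρ / εg) ≤ 2 * |Δ| / c * max 1 (ρ / εg) :=
      mul_le_mul_of_nonneg_left (le_max_right _ _) (by positivity)
    rw [hC₂, add_mul]
    linarith [le_max_left 1 (ρ / εg)]
  set M := max 1 (iterOrder ν Hν εg) with hM
  have hM1 : 1 ≤ M := le_max_left _ _
  refine ⟨hbound, exists_output (hPε ▸ hbound), ?_, ?_⟩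
  · refine hKle.trans ?_
    have : 0 ≤ C₂ * M := by positivity
    nlinarith
  intro k x G N hout
  obtain ⟨hgx, G', rfl, hr⟩ := hout
  have hk := (hrun k x G' N hr).2
  refine ⟨by omega, hPε ▸ hgx, ?_⟩
  set Y := cgOrder ν Hν UH εg with hY
  have hYeq := cgOrder_eq hν h.modulus_pos hε UH
  have hY0 : 0 ≤ Y := by
    rw [hY, hYeq]
    positivity
  set W := min (n : ℝ) (max 1 Y * Real.log (2 + Y)) with hW
  have hW2 : 1 / 2 ≤ W := half_le_workOrder hn hY0
  have hκ : kappa (2 * εg * ρ) UH ≤ (2 + Y) ^ 2 := by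
    have h1 : Y ^ 2 = UH / (εg * ρ) := by
      rw [hY, hYeq, div_pow, Real.sq_sqrt hUH.le, Real.sq_sqrt (by positivity)]
    have h2 : kappa (2 * εg * ρ) UH = Y ^ 2 / 2 + 2 := by
      rw [h1, kappa]
      field_simp
    nlinarith
  have ha : 0 < 2 * εg * ρ := by positivity
  have hκ0 : 0 < kappa (2 * εg * ρ) UH := by
    linarith [two_le_kappa ha hUH.le]
  have hcost : ∀ x ∈ levelSet f x₀, ∀ x' G N, NCGStep P f x x' G N →
      (G : ℝ) + N ≤ (6 + 4 * C₁) * W := by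
    intro x hx x' G N hs
    have h1 := hs.cost_le (J := C₁ * W) (by positivity) (fun hg j hj => by
      have hg0 : ∇ f x ≠ 0 := norm_pos_iff.1 ((hPε ▸ hε : 0 < P.εg).trans hg)
      subst hP
      simp only [sqrt_gammaNu hν h.modulus_pos hε] at hj
      have hjn : (j : ℝ) ≤ n := by
        exact_mod_cast (hj.regular (hessian_symm h.contDiff x) ha hζ.1 le_rfl hg0).le_dim
          (hessian_symm h.contDiff x)
      have hjl := (hj.index_le ha hζ le_rfl hUH.le (hhess x hx)).trans
        (index_bound_le hζ hY0 hκ0 hκ)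
      rw [hW, mul_min_of_nonneg _ _ (by linarith)]
      refine le_min (hjn.trans ?_) hjl
      exact le_mul_of_one_le_left (Nat.cast_nonneg n) hC₁1)
    linarith
  have h1 := hr.cost_le (fun k x G N hr => (hrun k x G N hr).1) hcost
  have h2 : (k : ℝ) + 1 ≤ C₂ * M := by
    refine le_trans ?_ hKle
    exact_mod_cast hk
  have h3 : 1 ≤ (6 + 4 * C₁) * W := by nlinarith
  -- The gradient at the output is charged as one more iteration; `k + 1 ≤ K1` leaves room for it.
  calc ((G' + 1 : ℕ) : ℝ) + N ≤ (k + 1) * ((6 + 4 * C₁) * W) := by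
        push_cast
        linarith
    _ ≤ C₂ * M * ((6 + 4 * C₁) * W) := by gcongr
    _ = C₂ * (6 + 4 * C₁) * M * W := by ring
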